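/- Let $K$ be a field, $Q$ a finite quiver and $\mathcal P$ its path algebra over $K$; its monomials are the directed paths (including the trivial path $1_v$ at each vertex $v$), the product of two monomials is their concatenation, or $0$ if they cannot be concatenated, and $\deg$ is the length of a path. Let $J$ be the ideal of $\mathcal P$ generated by the arrows, and let $\psi\colon\mathcal P\to\mathcal A$ be a surjective homomorphism of $K$-algebras with $J^N\subseteq\ker\psi\subseteq J^2$ for some $N$, so that $\mathcal A$ is a (finite-dimensional) basic algebra with quiver $Q$. **Orderings.** A monomial ordering of $\mathcal P$ is a total ordering of the monomials such that $b_1>b_2$ implies $b_1b>b_2b$ and $bb_1>bb_2$ whenever the two products compared are nonzero. Fix one. For a nonzero $p\in\mathcal P$ let $\mathrm{LM}(p)$ be the greatest monomial that occurs in $p$. A monomial of $\mathcal P$ is standard if it is not the leading monomial of an element of $\ker\psi$; the monomials of $\mathcal A$ are the $\psi(b)$ with $b$ standard, they are identified with $b=\lambda(\psi(b))$ and inherit the ordering, they form a $K$-basis of $\mathcal A$, and this defines $\mathrm{LM}(a)$ for $0\ne a\in\mathcal A$. A monomial $c$ of $\mathcal A$ is a small cofactor of a monomial $b$ of $\mathcal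 A$ if $\lambda(b)\lambda(c)$ is a (nonzero) standard monomial. Let $F=\mathcal A^r$ be the free right $\mathcal A$-module on $\mathfrak v_1,\dots,\mathfrak v_r$, with monomials $\mathfrak v_i b$ ($b$ a monomial of $\mathcal A$), and fix a total ordering of them such that $b_1>b_2$ implies $\mathfrak v_ib_1>\mathfrak v_ib_2$, and such that $\mathfrak v_ib_1>\mathfrak v_jb_2$ implies $\mathfrak v_ib_1b>\mathfrak v_j\mathrm{LM}(b_2b)$ or $b_2b=0$, for each small cofactor $b$ of $b_1$. This defines $\mathrm{LM}(f)$ for $0\neq f\in F$; a small cofactor of $\mathfrak v_ib$ is one of $b$. Let $M\subseteq F$ be the submodule generated by $\hat g_1,\dots,\hat g_m$, let $E=\mathcal P^m$ be the free right $\mathcal P$-module on $\mathfrak e_1,\dots,\mathfrak e_m$, with monomials $\mathfrak e_i b$ ($b$ a path) of degree $\deg b$, and let $ev\colon E\to M$ be given by $ev(\mathfrak e_i p)=\hat g_i\,\psi(p)$. Fix a total ordering of the monomials of $E$ such that $b_1>b_2$ implies $\mathfrak e_ib_1>\mathfrak e_ib_2$, such that $\mathfrak e_ib_1>\mathfrak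 e_jb_2$ implies $\mathfrak e_ib_1b>\mathfrak e_jb_2b$ whenever $b_1b\ne0\ne b_2b$, and which is a negative degree ordering: $\deg s>\deg t$ implies $s<t$. **Signed standard bases.** A signed element of $M$ is a pair $g=(g_u,\sigma(g))$ with $g_u\in M$ and $\sigma(g)$ a monomial of $E$ for which there is $\tilde g\in E$ with $\mathrm{LM}(\tilde g)=\sigma(g)$ and $ev(\tilde g)=g_u$; it is a signed element of $M\setminus\{0\}$ if $g_u\neq0$, and we write $\mathrm{LM}(g)=\mathrm{LM}(g_u)$. For a set $G$ of signed elements of $M\setminus\{0\}$, a monomial $s$ of $E$ and $0\ne f\in F$, call $f$ $s$-reducible (weakly $s$-reducible) with respect to $G$ if there are $g\in G$ and a small cofactor $c$ of $\mathrm{LM}(g)$ with $\mathrm{LM}(g)c=\mathrm{LM}(f)$, $\sigma(g)\lambda(c)\neq0$ and $\sigma(g)\lambda(c)<s$ (respectively $\le s$); otherwise $f$ is $s$-irreducible (respectively not weakly $s$-reducible). By convention $0$ is $s$-irreducible. A finite such $G$ is interreduced if for each $g\in G$ the element $g_u$ is $\sigma(g)$-irreducible with respect to $G$ and there is no $g'\in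 G\setminus\{g\}$ with a small cofactor $c$ of $\mathrm{LM}(g')$ such that $\mathrm{LM}(g')c=\mathrm{LM}(g)$ and $\sigma(g')\lambda(c)=\sigma(g)$. It is a signed standard basis of $M$ if, for each signed element $f$ of $M\setminus\{0\}$ such that $f_u$ is $\sigma(f)$-irreducible with respect to the set of all signed elements of $M\setminus\{0\}$, $f_u$ is weakly $\sigma(f)$-reducible with respect to $G$. **Theorem.** Let $G$ be an interreduced signed standard basis of $M$. For a monomial $\tau$ of $E$ let $B_\tau(M,G)$ be the set of all $g_u\cdot c$ with $g\in G$ and $c$ a small cofactor of $\mathrm{LM}(g)$ such that $0\ne\sigma(g)\lambda(c)\le\tau$ and $g_u\cdot c$ is $\sigma(g)\lambda(c)$-irreducible with respect to $G$. Let $d\geq1$, and let $\tau$ and $\tau'$ be the greatest monomials of $E$ of degree $d-1$ and $d$; if $E$ has no monomial of one of these degrees, the corresponding set $B$ is taken to be empty. Put $\mathrm{Rad}^0(M)=M$ and let $\mathrm{Rad}^{k}(M)$ be the intersection of all maximal submodules of $\mathrm{Rad}^{k-1}(M)$. Then $B_\tau(M,G)\setminus B_{\tau'}(M,G)\subseteq\mathrm{Rad}^{d-1}(M)$,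 and the classes $[f]$ of the elements $f\in B_\tau(M,G)\setminus B_{\tau'}(M,G)$ are pairwise distinct and form a $K$-vector space basis of the $d$-th Loewy layer $\mathrm{Rad}^{d-1}(M)/\mathrm{Rad}^d(M)$. -/

import Mathlib

namespace SignedStd

universe v u w

/-- A monomial of the path algebra of a quiver: a directed path with its two end points. -/
@[ext]
structure Mon (V : Type u) [Quiver.{v} V] where
  src : V
  tgt : V
  path : Quiver.Path src tgt

namespace Mon

variable {V : Type u} [Quiver.{v} V]

/-- The degree of a monomial is the length of the path. -/
def deg (b : Mon V) : ℕ := b.path.length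

/-- The trivial path at a vertex. -/
def triv (a : V) : Mon V := ⟨a, a, Quiver.Path.nil⟩

open Classical in
/-- Concatenation of paths; `none` stands for the product `0` of paths that do not meet. -/
noncomputable def mul (b c : Mon V) : Option (Mon V) :=
  if h : b.tgt = c.src then some ⟨b.src, c.tgt, b.path.comp (c.path.cast h.symm rfl)⟩ else none

theorem mul_mk {a b c : V} (p : Quiver.Path a b) (q : Quiver.Path b c) :
    mul ⟨a, b, p⟩ ⟨b, c, q⟩ = some ⟨a, c, p.comp q⟩ := by
  simp [mul]

theorem mul_of_ne {b c : Mon V} (h : b.tgt ≠ c.src) : mul b c = none := by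
  simp [mul, h]

theorem mul_triv (b : Mon V) : mul b (triv b.tgt) = some b := by
  simp [mul, triv]

theorem triv_mul (b : Mon V) : mul (triv b.src) b = some b := by
  simp [mul, triv]

theorem mul_bind_assoc (b c d : Mon V) :
    (mul b c).bind (fun t => mul t d) = (mul c d).bind (fun t => mul b t) := by
  obtain ⟨b₁, b₂, p⟩ := b
  obtain ⟨c₁, c₂, q⟩ := c
  obtain ⟨d₁, d₂, r⟩ := d
  by_cases h : b₂ = c₁
  · subst h
    by_cases h' : c₂ = d₁
    · subst h'
      simp [mul_mk, Quiver.Path.comp_assoc]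
    · rw [mul_mk, mul_of_ne (b := ⟨b₂, c₂, q⟩) (by simpa using h')]
      simp [mul_of_ne (b := ⟨b₁, c₂, p.comp q⟩) (c := ⟨d₁, d₂, r⟩) h']
  · rw [mul_of_ne (b := ⟨b₁, b₂, p⟩) (by simpa using h)]
    by_cases h' : c₂ = d₁
    · subst h'
      simp [mul_mk, mul_of_ne (b := ⟨b₁, b₂, p⟩) (c := ⟨c₁, d₂, q.comp r⟩) h]
    · simp [mul_of_ne (b := ⟨c₁, c₂, q⟩) (c := ⟨d₁, d₂, r⟩) h']

end Mon

/-- The path algebra of the quiver `V` over `K`: formal linear combinations of paths. -/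
def PathAlgebra (K : Type w) (V : Type u) [Field K] [Quiver.{v} V] : Type (max u v w) :=
  Mon V →₀ K

namespace PathAlgebra

variable {K : Type w} {V : Type u} [Field K] [Quiver.{v} V]

noncomputable instance : AddCommGroup (PathAlgebra K V) :=
  inferInstanceAs (AddCommGroup (Mon V →₀ K))

noncomputable instance : Module K (PathAlgebra K V) :=
  inferInstanceAs (Module K (Mon V →₀ K))

/-- The coefficient of the monomial `b` in `p`. -/
def coeff (p : PathAlgebra K V) (b : Mon V) : K :=
  (show Mon V →₀ K from p) b

/-- The monomial `b` as an element of the path algebra. -/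
noncomputable def mon (K : Type w) [Field K] (b : Mon V) : PathAlgebra K V :=
  Finsupp.single b (1 : K)

/-- A product of two monomials, or `0`, as an element of the path algebra. -/
noncomputable def ofOption (K : Type w) [Field K] (b : Option (Mon V)) : PathAlgebra K V :=
  b.elim 0 (mon K)

/-- The bilinear extension of the concatenation of paths. -/
noncomputable def mulLin : PathAlgebra K V →ₗ[K] PathAlgebra K V →ₗ[K] PathAlgebra K V :=
  Finsupp.linearCombination K (fun b : Mon V =>
    (Finsupp.linearCombination K (fun c : Mon V => ofOption K (Mon.mul b c)) :
      (Mon V →₀ K) →ₗ[K] PathAlgebra K V))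

theorem mulLin_mon (b c : Mon V) :
    mulLin (mon K b) (mon K c) = ofOption K (Mon.mul b c) := by
  unfold mulLin mon
  erw [Finsupp.linearCombination_single, one_smul, Finsupp.linearCombination_single, one_smul]

theorem induction_mon {motive : PathAlgebra K V → Prop} (p : PathAlgebra K V)
    (zero : motive 0) (add : ∀ p q, motive p → motive q → motive (p + q))
    (smul : ∀ (a : K) (b : Mon V), motive (a • mon K b)) : motive p := by
  refine Finsupp.induction_linear (motive := motive) p zero add (fun b a => ?_)
  have h := smul a b
  have e : a • mon K b = (Finsupp.single b a : Mon V →₀ K) := by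
    change a • (Finsupp.single b (1 : K) : Mon V →₀ K) = _
    simp
  rwa [e] at h

theorem mulLin_ofOption_left (t : Option (Mon V)) (d : Mon V) :
    mulLin (ofOption K t) (mon K d) = ofOption K (t.bind (fun t => Mon.mul t d)) := by
  cases t with
  | none => simp [ofOption]
  | some t => simpa [ofOption] using mulLin_mon (K := K) t d

theorem mulLin_ofOption_right (b : Mon V) (t : Option (Mon V)) :
    mulLin (mon K b) (ofOption K t) = ofOption K (t.bind (fun t => Mon.mul b t)) := by
  cases t with
  | none => simp [ofOption]
  | some t => simpa [ofOption] using mulLin_mon (K := K) b t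

theorem mulLin_assoc (p q r : PathAlgebra K V) :
    mulLin (mulLin p q) r = mulLin p (mulLin q r) := by
  induction p using induction_mon with
  | zero => simp
  | add p p' h h' => simp [h, h']
  | smul x b =>
    induction q using induction_mon with
    | zero => simp
    | add q q' h h' =>
      simp only [map_add, LinearMap.add_apply] at h h' ⊢
      rw [h, h']
    | smul y c =>
      induction r using induction_mon with
      | zero => simp
      | add r r' h h' =>
        simp only [map_add] at h h' ⊢
        rw [h, h']
      | smul z d =>
        simp only [map_smul, LinearMap.smul_apply, mulLin_mon, mulLin_ofOption_left,
          mulLin_ofOption_right, Mon.mul_bind_assoc]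

noncomputable instance : Mul (PathAlgebra K V) := ⟨fun p q => mulLin p q⟩

theorem mul_def (p q : PathAlgebra K V) : p * q = mulLin p q := rfl

theorem mon_mul_mon (b c : Mon V) : mon K b * mon K c = ofOption K (Mon.mul b c) :=
  mulLin_mon b c

variable [Fintype V]

/-- The unit of the path algebra is the sum of the trivial paths. -/
noncomputable instance : One (PathAlgebra K V) := ⟨∑ a : V, mon K (Mon.triv a)⟩

theorem one_def : (1 : PathAlgebra K V) = ∑ a : V, mon K (Mon.triv a) := rfl

theorem mulLin_one_left (p : PathAlgebra K V) : mulLin 1 p = p := by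
  induction p using induction_mon with
  | zero => simp
  | add p q h h' => simp [h, h']
  | smul x b =>
    rw [map_smul, one_def, map_sum, LinearMap.sum_apply, Finset.sum_eq_single b.src]
    · rw [mulLin_mon, Mon.triv_mul]; rfl
    · intro a _ h
      rw [mulLin_mon, Mon.mul_of_ne (by simpa [Mon.triv] using h)]; rfl
    · simp

theorem mulLin_one_right (p : PathAlgebra K V) : mulLin p 1 = p := by
  induction p using induction_mon with
  | zero => simp
  | add p q h h' => simp [h, h']
  | smul x b =>
    rw [map_smul, LinearMap.smul_apply, one_def, map_sum, Finset.sum_eq_single b.tgt]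
    · rw [mulLin_mon, Mon.mul_triv]; rfl
    · intro a _ h
      rw [mulLin_mon, Mon.mul_of_ne (by simpa [Mon.triv] using h.symm)]; rfl
    · simp

noncomputable instance : Ring (PathAlgebra K V) :=
  { (inferInstance : AddCommGroup (PathAlgebra K V)),
    (inferInstance : Mul (PathAlgebra K V)),
    (inferInstance : One (PathAlgebra K V)) with
    left_distrib := fun p q r => by simp [mul_def]
    right_distrib := fun p q r => by simp [mul_def]
    zero_mul := fun p => by simp [mul_def]
    mul_zero := fun p => by simp [mul_def]
    mul_assoc := mulLin_assoc
    one_mul := mulLin_one_left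
    mul_one := mulLin_one_right }

noncomputable instance : Algebra K (PathAlgebra K V) :=
  Algebra.ofModule (fun x p q => by simp [mul_def]) (fun x p q => by simp [mul_def])

end PathAlgebra

open PathAlgebra

section Algebras

variable {K : Type w} {V : Type u} [Field K] [Quiver.{v} V] [Fintype V]
variable {A : Type*} [Ring A] [Algebra K A] (ψ : PathAlgebra K V →ₐ[K] A)

/-- `ψ` presents `A` as a basic algebra: `A` is the quotient of the path algebra by an admissible
ideal, that is, by an ideal `ker ψ` with `J ^ N ⊆ ker ψ ⊆ J ^ 2` for some `N`, where `J` is the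
ideal generated by the arrows (so that `J ^ k` is spanned by the paths of length at least `k`). -/
structure IsBasicPresentation : Prop where
  surjective : Function.Surjective ψ
  ker_le : ∀ p, ψ p = 0 → ∀ b, p.coeff b ≠ 0 → 2 ≤ b.deg
  le_ker : ∃ N : ℕ, ∀ p : PathAlgebra K V, (∀ b, p.coeff b ≠ 0 → N ≤ b.deg) → ψ p = 0

/-- A monomial ordering of the path algebra: a total ordering of the monomials that is compatible
with nonzero products from both sides. -/
structure IsMonomialOrder (V : Type u) [Quiver.{v} V] [LinearOrder (Mon V)] : Prop where
  mul_right : ∀ b₁ b₂ b c₁ c₂ : Mon V, b₁ > b₂ → b₁.mul b = some c₁ → b₂.mul b = some c₂ → c₁ > c₂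
  mul_left : ∀ b₁ b₂ b c₁ c₂ : Mon V, b₁ > b₂ → b.mul b₁ = some c₁ → b.mul b₂ = some c₂ → c₁ > c₂

/-- `b` is the leading monomial of the element `p` of the path algebra. -/
def IsLead [LinearOrder (Mon V)] (p : PathAlgebra K V) (b : Mon V) : Prop :=
  p.coeff b ≠ 0 ∧ ∀ c, p.coeff c ≠ 0 → c ≤ b

/-- Standard monomials: those that are not leading monomials of elements of `ker ψ`. A monomial
`ψ b` of `A` is represented throughout by its lift, the standard monomial `b`. -/
def IsStd [LinearOrder (Mon V)] (b : Mon V) : Prop :=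
  ∀ p, ψ p = 0 → ¬ IsLead p b

/-- The standard monomial `b` is (the lift of) the leading monomial of the element `a` of `A`. -/
def IsLeadA [LinearOrder (Mon V)] (a : A) (b : Mon V) : Prop :=
  ∃ p : PathAlgebra K V, ψ p = a ∧ (∀ c, p.coeff c ≠ 0 → IsStd ψ c) ∧ IsLead p b

/-- The monomial `c` of `A` is a small cofactor of the monomial `b` of `A`: the product of the
lifts is again a standard monomial, `b * c = d`. -/
def IsSmallCofactor [LinearOrder (Mon V)] (b c d : Mon V) : Prop :=
  IsStd ψ b ∧ IsStd ψ c ∧ b.mul c = some d ∧ IsStd ψ d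

end Algebras

section ModuleE

/-- The monomials `𝔢ᵢ · b` of the free right module `E = 𝒫 ^ m` over the path algebra. -/
@[ext]
structure EMon (m : ℕ) (V : Type u) [Quiver.{v} V] where
  idx : Fin m
  mon : Mon V

variable {m : ℕ} {V : Type u} [Quiver.{v} V]

/-- The degree of a monomial of `E`. -/
def EMon.deg (s : EMon m V) : ℕ := s.mon.deg

/-- The product of a monomial of `E` and a path, `none` if it is `0`. -/
noncomputable def EMon.mul (s : EMon m V) (c : Mon V) : Option (EMon m V) :=
  (s.mon.mul c).map (fun b => ⟨s.idx, b⟩)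

/-- A monomial ordering on `E` that is compatible with the monomial ordering of the path algebra. -/
structure IsMonomialOrderE (m : ℕ) (V : Type u) [Quiver.{v} V] [LinearOrder (Mon V)]
    [LinearOrder (EMon m V)] : Prop where
  compat : ∀ (i : Fin m) (b₁ b₂ : Mon V), b₁ > b₂ → (⟨i, b₁⟩ : EMon m V) > ⟨i, b₂⟩
  mul_right : ∀ (s₁ s₂ : EMon m V) (b : Mon V) (t₁ t₂ : EMon m V), s₁ > s₂ →
    s₁.mul b = some t₁ → s₂.mul b = some t₂ → t₁ > t₂

/-- The ordering on `E` is a negative degree ordering. -/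
def IsNegDegOrderE (m : ℕ) (V : Type u) [Quiver.{v} V] [LinearOrder (EMon m V)] : Prop :=
  ∀ s₁ s₂ : EMon m V, s₁.deg > s₂.deg → s₂ > s₁

/-- `s` is the leading monomial of the element `f` of `E`. -/
def IsLeadE {K : Type w} [Field K] [LinearOrder (EMon m V)]
    (f : Fin m → PathAlgebra K V) (s : EMon m V) : Prop :=
  (f s.idx).coeff s.mon ≠ 0 ∧ ∀ t : EMon m V, (f t.idx).coeff t.mon ≠ 0 → t ≤ s

/-- `τ` is the greatest monomial of `E` of degree `d`; it is `⊥` if `E` has no monomial of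
degree `d`. -/
def IsTopOfDegree [LinearOrder (EMon m V)] (d : ℕ) (τ : WithBot (EMon m V)) : Prop :=
  (∀ s : EMon m V, s.deg = d → (s : WithBot (EMon m V)) ≤ τ) ∧
    (τ ≠ ⊥ → ∃ s : EMon m V, s.deg = d ∧ (s : WithBot (EMon m V)) = τ)

end ModuleE

section ModuleF

variable {K : Type w} {V : Type u} [Field K] [Quiver.{v} V] [Fintype V]
variable {A : Type*} [Ring A] [Algebra K A] (ψ : PathAlgebra K V →ₐ[K] A)
variable [LinearOrder (Mon V)]

/-- The monomials `𝔳ᵢ · b` of the free right module `F = A ^ r`. -/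
@[ext]
structure FMon (r : ℕ) where
  idx : Fin r
  mon : Mon V
  std : IsStd ψ mon

/-- A monomial ordering on `F` that is compatible with the monomial ordering of `A`. -/
structure IsMonomialOrderF (r : ℕ) [LinearOrder (FMon ψ r)] : Prop where
  compat : ∀ t₁ t₂ : FMon ψ r, t₁.idx = t₂.idx → t₁.mon > t₂.mon → t₁ > t₂
  mul_right : ∀ (t₁ t₂ : FMon ψ r) (b : Mon V) (u₁ u₂ : FMon ψ r), t₁ > t₂ →
    u₁.idx = t₁.idx → IsSmallCofactor ψ t₁.mon b u₁.mon →
    u₂.idx = t₂.idx → IsLeadA ψ (ψ (mon K t₂.mon) * ψ (mon K b)) u₂.mon → u₁ > u₂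

variable {m r : ℕ} [LinearOrder (FMon ψ r)]

/-- `t` is the leading monomial of the element `f` of `F`, with respect to the expansion of `f`
in the monomials of `F`. -/
def IsLeadF (f : Fin r → A) (t : FMon ψ r) : Prop :=
  ∃ p : Fin r → PathAlgebra K V, (∀ i, ψ (p i) = f i) ∧
    (∀ i c, (p i).coeff c ≠ 0 → IsStd ψ c) ∧
    (p t.idx).coeff t.mon ≠ 0 ∧ ∀ u : FMon ψ r, (p u.idx).coeff u.mon ≠ 0 → u ≤ t

/-- The evaluation `E → M`, `𝔢ᵢ · c ↦ ĝᵢ · ψ c`. The right `A`-module structure on `F` is written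
as a left module structure over the opposite ring. -/
noncomputable def ev (ghat : Fin m → Fin r → A) (f : Fin m → PathAlgebra K V) : Fin r → A :=
  ∑ i, MulOpposite.op (ψ (f i)) • ghat i

/-- `(f, s)` is a signed element of the module generated by the `ĝᵢ`. -/
def IsSigned [LinearOrder (EMon m V)] (ghat : Fin m → Fin r → A)
    (x : (Fin r → A) × EMon m V) : Prop :=
  ∃ f : Fin m → PathAlgebra K V, IsLeadE f x.2 ∧ ev ψ ghat f = x.1

/-- For some small cofactor `c` of `LM g`, we have `LM g * c = LM f` and `σ g * c = q`. -/
def TopReduces (g : (Fin r → A) × EMon m V) (f : Fin r → A) (q : EMon m V) : Prop :=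
  ∃ (t u : FMon ψ r) (c : Mon V), IsLeadF ψ g.1 t ∧ IsLeadF ψ f u ∧
    t.idx = u.idx ∧ IsSmallCofactor ψ t.mon c u.mon ∧ g.2.mul c = some q

variable [LinearOrder (EMon m V)]

/-- `f` is `s`-reducible with respect to `G`. -/
def Reducible (G : Set ((Fin r → A) × EMon m V)) (f : Fin r → A) (s : EMon m V) : Prop :=
  ∃ g ∈ G, ∃ q, TopReduces ψ g f q ∧ q < s

/-- `f` is weakly `s`-reducible with respect to `G`. -/
def WeaklyReducible (G : Set ((Fin r → A) × EMon m V)) (f : Fin r → A) (s : EMon m V) : Prop :=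
  ∃ g ∈ G, ∃ q, TopReduces ψ g f q ∧ q ≤ s

/-- `f` is `s`-irreducible with respect to `G`. -/
def SigIrreducible (G : Set ((Fin r → A) × EMon m V)) (f : Fin r → A) (s : EMon m V) : Prop :=
  f = 0 ∨ ¬ Reducible ψ G f s

/-- The signed elements of `M \ {0}`, where `M` is generated by the `ĝᵢ`. -/
def signedElements (ghat : Fin m → Fin r → A) : Set ((Fin r → A) × EMon m V) :=
  {x | IsSigned ψ ghat x ∧ x.1 ≠ 0}

/-- A signed subset `G` is interreduced: each `g ∈ G` is `σ g`-irreducible with respect to `G`,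
and there is no other `g' ∈ G` with a small cofactor `c` of `LM g'` such that `LM g' * c = LM g`
and `σ g' * c = σ g`. -/
def IsInterreduced (G : Set ((Fin r → A) × EMon m V)) : Prop :=
  ∀ g ∈ G, SigIrreducible ψ G g.1 g.2 ∧ ∀ g' ∈ G, g' ≠ g → ¬ TopReduces ψ g' g.1 g.2

/-- `G` is a signed standard basis of the module `M` generated by the `ĝᵢ`: a finite signed subset
of `M \ {0}` such that each signed element `f` of `M \ {0}` that is `σ f`-irreducible with respect
to all signed elements of `M \ {0}` is weakly `σ f`-reducible with respect to `G`. -/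
structure IsSignedStandardBasis (ghat : Fin m → Fin r → A)
    (G : Set ((Fin r → A) × EMon m V)) : Prop where
  finite : G.Finite
  signed : G ⊆ signedElements ψ ghat
  reducible : ∀ f ∈ signedElements ψ ghat,
    SigIrreducible ψ (signedElements ψ ghat) f.1 f.2 → WeaklyReducible ψ G f.1 f.2

/-- The set `B_τ(M, G)` of all products `g * c` with `g ∈ G` and a small cofactor `c` of `LM g`,
such that `σ g * c ≤ τ` and `g * c` is `σ g * c`-irreducible with respect to `G`. It is empty for
`τ = ⊥`. -/
def layerBasis (G : Set ((Fin r → A) × EMon m V)) (τ : WithBot (EMon m V)) : Set (Fin r → A) :=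
  {f | ∃ g ∈ G, ∃ (t : FMon ψ r) (c d : Mon V) (q : EMon m V), IsLeadF ψ g.1 t ∧
    IsSmallCofactor ψ t.mon c d ∧ g.2.mul c = some q ∧ (q : WithBot (EMon m V)) ≤ τ ∧
    f = MulOpposite.op (ψ (mon K c)) • g.1 ∧ SigIrreducible ψ G f q}

end ModuleF

section Radical

/-- The radical of a submodule `N`: the intersection of all maximal submodules of `N`, viewed as a
submodule of the ambient module. -/
def rad {R X : Type*} [Ring R] [AddCommGroup X] [Module R X] (N : Submodule R X) :
    Submodule R X :=
  (Module.jacobson R N).map N.subtype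

/-- The iterated radicals `Rad ^ d (N)`. -/
def radPow {R X : Type*} [Ring R] [AddCommGroup X] [Module R X] (N : Submodule R X) :
    ℕ → Submodule R X
  | 0 => N
  | d + 1 => rad (radPow N d)

/-- The `d`-th Loewy layer `Rad ^ (d - 1) (N) / Rad ^ d (N)`, for `d ≥ 1`. -/
abbrev LoewyLayer {R X : Type*} [Ring R] [AddCommGroup X] [Module R X] (N : Submodule R X)
    (d : ℕ) : Type _ :=
  radPow N (d - 1) ⧸ (radPow N d).submoduleOf (radPow N (d - 1))

end Radical

end SignedStd

open SignedStd

namespace SignedStd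

universe u v w

open PathAlgebra

/-! ### Paths: cancellation, refinement of factorizations, prefixes, finiteness in bounded degree.
-/

namespace Mon

variable {V : Type u} [Quiver.{v} V]

/-! The ordered monomials of `E` filter `M` by the `K`-subspaces `evSpan (Set.Iic q)` of elements
with an expression using only monomials up to `q`. Call a monomial `t` of `F` new at `q`
(`IsNewLead`) if it is the leading monomial of an element of this subspace but of no element of
`evSpan (Set.Iio q)`. Each leading monomial that occurs is new at exactly one `q`
(`IsNewLead.unique`, `exists_isNewLead`). Existence needs an argument, since a negative degree
ordering need not be a well-ordering: paths of length at least `N` act as zero, so only finitely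
many `q` carry nonzero elements.

Every pair `(t, q)` with `t` new at `q` is realised by a product of an element of a signed standard
basis with a small cofactor (`IsNewLead.exists_mem`), and by only one such product if the basis is
interreduced (`IsInterreduced.eq_of_mul_eq`). Conversely, an irreducible product has a leading
monomial that is new at its signature (`isNewLead_of_sigIrreducible`). So the elements of
`layerBasis` have distinct leading monomials, and these are all the leading monomials of the
evaluations of monomials bounded by `τ`. Triangularity makes the set a `K`-basis of that subspace
(`linearIndependent_layerBasis`, `span_layerBasis`).

For a negative degree ordering, being bounded by the greatest monomial of degree `k` means having
degree at least `k` (`IsTopOfDegree.le_iff`). The subspace in question is therefore the image of the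
monomials of degree at least `k`, which is the `k`-th radical: a Nakayama argument gives one
inclusion, explicit maximal submodules of codimension one give the other (`radPow_eq_degSpan`). The
bases of consecutive radicals are nested, so the elements of the larger one outside the smaller one
give a basis of the quotient. -/

theorem mul_eq_some {b c d : Mon V} (h : b.mul c = some d) :
    ∃ (x y z : V) (p : Quiver.Path x y) (q : Quiver.Path y z),
      b = ⟨x, y, p⟩ ∧ c = ⟨y, z, q⟩ ∧ d = ⟨x, z, p.comp q⟩ := by
  obtain ⟨x, y, p⟩ := b
  obtain ⟨y', z, q⟩ := c
  by_cases hy : y = y'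
  · subst hy
    rw [mul_mk] at h
    exact ⟨x, y, z, p, q, rfl, rfl, (Option.some.inj h).symm⟩
  · rw [mul_of_ne (by simpa using hy)] at h
    cases h

theorem deg_mul {b c d : Mon V} (h : b.mul c = some d) : d.deg = b.deg + c.deg := by
  obtain ⟨x, y, z, p, q, rfl, rfl, rfl⟩ := mul_eq_some h
  simp [deg]

theorem mul_right_cancel {b b' c d : Mon V} (h : b.mul c = some d) (h' : b'.mul c = some d) :
    b = b' := by
  obtain ⟨x, y, z, p, q, rfl, rfl, rfl⟩ := mul_eq_some h
  obtain ⟨x', y', z', p', q', rfl, hc, hd⟩ := mul_eq_some h'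
  simp only [Mon.mk.injEq] at hc hd
  obtain ⟨rfl, rfl, hq⟩ := hc
  obtain ⟨rfl, -, hp⟩ := hd
  cases hq
  have := Quiver.Path.comp_injective_left _ (eq_of_heq hp)
  rw [this]

theorem mul_left_cancel {b c c' d : Mon V} (h : b.mul c = some d) (h' : b.mul c' = some d) :
    c = c' := by
  obtain ⟨x, y, z, p, q, rfl, rfl, rfl⟩ := mul_eq_some h
  obtain ⟨x', y', z', p', q', hb, rfl, hd⟩ := mul_eq_some h'
  simp only [Mon.mk.injEq] at hb hd
  obtain ⟨rfl, rfl, hp⟩ := hb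
  obtain ⟨-, rfl, hq⟩ := hd
  cases hp
  have := Quiver.Path.comp_injective_right _ (eq_of_heq hq)
  rw [this]

/-- Two factorizations of the same path: the one with the longer right factor refines the other. -/
theorem exists_middle {b c b' c' d : Mon V} (h : b.mul c = some d) (h' : b'.mul c' = some d)
    (hl : c.deg ≤ c'.deg) : ∃ e, e.mul c = some c' ∧ b'.mul e = some b := by
  obtain ⟨x, y, z, p, q, rfl, rfl, rfl⟩ := mul_eq_some h
  obtain ⟨x', y', z', p', q', rfl, rfl, hd⟩ := mul_eq_some h'
  simp only [Mon.mk.injEq] at hd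
  obtain ⟨rfl, rfl, hp⟩ := hd
  replace hp := eq_of_heq hp
  clear h h'
  simp only [deg] at hl
  induction q with
  | nil => exact ⟨⟨_, _, q'⟩, by simp [mul_mk], by rw [mul_mk, ← hp]; simp⟩
  | cons q a ih =>
    cases q' with
    | nil => simp at hl
    | cons q' a' =>
      simp only [Quiver.Path.comp_cons] at hp
      obtain rfl := Quiver.Path.obj_eq_of_cons_eq_cons hp
      have h1 := Quiver.Path.heq_of_cons_eq_cons hp
      have h2 := Quiver.Path.hom_heq_of_cons_eq_cons hp
      obtain rfl := eq_of_heq h2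
      obtain ⟨e, he, he'⟩ := ih q' (by simpa using hl) (eq_of_heq h1)
      refine ⟨e, ?_, he'⟩
      obtain ⟨x₁, y₁, z₁, p₁, q₁, rfl, hq, hq'⟩ := mul_eq_some he
      simp only [Mon.mk.injEq] at hq hq'
      obtain ⟨rfl, rfl, hq⟩ := hq
      obtain ⟨rfl, -, hq'⟩ := hq'
      cases hq
      cases hq'
      rw [mul_mk]
      simp

theorem exists_prefix (b : Mon V) {k : ℕ} (hk : k ≤ b.deg) :
    ∃ c e : Mon V, c.deg = k ∧ c.mul e = some b := by
  obtain ⟨x, y, p⟩ := b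
  induction p with
  | nil =>
    simp only [deg, Quiver.Path.length_nil, Nat.le_zero] at hk
    exact ⟨⟨x, x, .nil⟩, ⟨x, x, .nil⟩, by simp [deg, hk], by simp [mul_mk]⟩
  | @cons y z p a ih =>
    rcases Nat.lt_or_ge (Mon.deg ⟨x, y, p⟩) k with h | h
    · refine ⟨⟨x, z, p.cons a⟩, ⟨z, z, .nil⟩, ?_, by simp [mul_mk]⟩
      simp only [deg, Quiver.Path.length_cons] at hk h ⊢
      omega
    · obtain ⟨c, e, hc, hce⟩ := ih h
      obtain ⟨x₁, y₁, z₁, p₁, q₁, rfl, rfl, hq'⟩ := mul_eq_some hce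
      simp only [Mon.mk.injEq] at hq'
      obtain ⟨rfl, rfl, hq'⟩ := hq'
      cases hq'
      exact ⟨_, ⟨_, _, q₁.cons a⟩, hc, by rw [mul_mk]; simp⟩

theorem deg_eq_zero {b : Mon V} (h : b.deg = 0) : ∃ a, b = triv a := by
  obtain ⟨x, y, p⟩ := b
  obtain rfl := Quiver.Path.eq_of_length_zero p h
  obtain rfl := Quiver.Path.eq_nil_of_length_zero p h
  exact ⟨x, rfl⟩

theorem finite_deg_eq [Finite V] [∀ a b : V, Finite (a ⟶ b)] (n : ℕ) :
    {b : Mon V | b.deg = n}.Finite := by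
  induction n with
  | zero =>
    refine (Set.finite_range (triv : V → Mon V)).subset fun b hb => ?_
    obtain ⟨a, rfl⟩ := deg_eq_zero hb
    exact ⟨a, rfl⟩
  | succ n ih =>
    refine (ih.biUnion fun b _ => Set.finite_iUnion fun w : V =>
      Set.finite_range fun a : b.tgt ⟶ w => (⟨b.src, w, b.path.cons a⟩ : Mon V)).subset ?_
    rintro ⟨x, y, p⟩ hb
    cases p with
    | nil => simp [deg] at hb
    | @cons z _ p a =>
      simp only [Set.mem_iUnion]
      exact ⟨⟨x, z, p⟩, by simpa [deg] using hb, y, a, rfl⟩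

theorem finite_deg_lt [Finite V] [∀ a b : V, Finite (a ⟶ b)] (n : ℕ) :
    {b : Mon V | b.deg < n}.Finite := by
  refine ((Set.finite_lt_nat n).biUnion fun k _ => finite_deg_eq (V := V) k).subset fun b hb => ?_
  simpa using hb

end Mon

/-! ### Coefficients and supports in the path algebra. -/

namespace PathAlgebra

variable {K : Type w} {V : Type u} [Field K] [Quiver.{v} V]

/-- The coefficient of a monomial as a linear map. -/
noncomputable def lcoeff (b : Mon V) : PathAlgebra K V →ₗ[K] K := Finsupp.lapply b

@[simp] theorem coeff_zero (b : Mon V) : (0 : PathAlgebra K V).coeff b = 0 := rfl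

@[simp] theorem coeff_add (p q : PathAlgebra K V) (b : Mon V) :
    (p + q).coeff b = p.coeff b + q.coeff b := rfl

@[simp] theorem coeff_smul (a : K) (p : PathAlgebra K V) (b : Mon V) :
    (a • p).coeff b = a * p.coeff b := rfl

theorem coeff_sum {ι : Type*} (s : Finset ι) (f : ι → PathAlgebra K V) (b : Mon V) :
    (∑ i ∈ s, f i).coeff b = ∑ i ∈ s, (f i).coeff b :=
  map_sum (lcoeff b) f s

open Classical in
theorem coeff_mon (b c : Mon V) : (mon K b).coeff c = if b = c then 1 else 0 :=
  Finsupp.single_apply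

/-- The finite set of monomials that occur in an element of the path algebra. -/
noncomputable def support (p : PathAlgebra K V) : Finset (Mon V) :=
  Finsupp.support (show Mon V →₀ K from p)

theorem mem_support {p : PathAlgebra K V} {b : Mon V} : b ∈ p.support ↔ p.coeff b ≠ 0 :=
  Finsupp.mem_support_iff

theorem ext_coeff {p q : PathAlgebra K V} (h : ∀ b, p.coeff b = q.coeff b) : p = q :=
  Finsupp.ext h

theorem sum_coeff_mon (p : PathAlgebra K V) : ∑ b ∈ p.support, p.coeff b • mon K b = p := by
  classical
  refine ext_coeff fun c => ?_
  rw [coeff_sum]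
  simp only [coeff_smul, coeff_mon, mul_ite, mul_one, mul_zero, Finset.sum_ite_eq',
    mem_support]
  split_ifs with h
  · rfl
  · exact (not_not.mp h).symm

theorem map_eq_sum [Fintype V] {A : Type*} [Ring A] [Algebra K A] (ψ : PathAlgebra K V →ₐ[K] A)
    (p : PathAlgebra K V) : ψ p = ∑ b ∈ p.support, p.coeff b • ψ (mon K b) := by
  conv_lhs => rw [← sum_coeff_mon p]
  simp

theorem mon_mul_mon_of_eq_some [Fintype V] {b c d : Mon V} (h : b.mul c = some d) :
    mon K b * mon K c = mon K d := by
  rw [mon_mul_mon, h]; rfl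

theorem mon_mul_mon_of_eq_none [Fintype V] {b c : Mon V} (h : b.mul c = none) :
    mon K b * mon K c = 0 := by
  rw [mon_mul_mon, h]; rfl

end PathAlgebra

open MulOpposite

theorem isLead_mon {K : Type w} {V : Type u} [Field K] [Quiver.{v} V] [LinearOrder (Mon V)]
    (b : Mon V) : IsLead (mon K b) b := by
  classical
  refine ⟨by simp [coeff_mon], fun c hc => ?_⟩
  rw [coeff_mon] at hc
  split_ifs at hc with h
  · exact h.ge
  · exact absurd rfl hc

/-! ### Coefficients of a product with a path. -/

section Product

variable {K : Type w} {V : Type u} [Field K] [Quiver.{v} V] [Fintype V]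

/-- Paths cancel on the right, so distinct terms of `p` cannot collide after multiplication by `c`.
-/
theorem coeff_mul_mon {p : PathAlgebra K V} {b c d : Mon V} (h : b.mul c = some d) :
    (p * mon K c).coeff d = p.coeff b := by
  classical
  have e : (p * mon K c).coeff d =
      ∑ b' ∈ p.support, p.coeff b' * (mon K b' * mon K c).coeff d := by
    conv_lhs => rw [← sum_coeff_mon p]
    rw [Finset.sum_mul, coeff_sum]
    simp
  rw [e, Finset.sum_eq_single b]
  · rw [mon_mul_mon_of_eq_some h, coeff_mon, if_pos rfl, mul_one]
  · intro b' _ hne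
    cases h' : b'.mul c with
    | none => rw [mon_mul_mon_of_eq_none h', coeff_zero, mul_zero]
    | some d' =>
      rw [mon_mul_mon_of_eq_some h', coeff_mon, if_neg, mul_zero]
      rintro rfl
      exact hne (Mon.mul_right_cancel h' h)
  · intro hb
    rw [not_not.mp (mt mem_support.mpr hb), zero_mul]

theorem exists_of_coeff_mul_mon_ne_zero {p : PathAlgebra K V} {c d : Mon V}
    (h : (p * mon K c).coeff d ≠ 0) : ∃ b, p.coeff b ≠ 0 ∧ b.mul c = some d := by
  classical
  have e : (p * mon K c).coeff d =
      ∑ b' ∈ p.support, p.coeff b' * (mon K b' * mon K c).coeff d := by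
    conv_lhs => rw [← sum_coeff_mon p]
    rw [Finset.sum_mul, coeff_sum]
    simp
  rw [e] at h
  obtain ⟨b, hb, hb'⟩ := Finset.exists_ne_zero_of_sum_ne_zero h
  refine ⟨b, mem_support.mp hb, ?_⟩
  have h0 := right_ne_zero_of_mul hb'
  cases h' : b.mul c with
  | none => rw [mon_mul_mon_of_eq_none h', coeff_zero] at h0; exact absurd rfl h0
  | some d' =>
    rw [mon_mul_mon_of_eq_some h', coeff_mon] at h0
    split_ifs at h0 with hd
    · rw [hd]
    · exact absurd rfl h0

end Product

/-! ### Standard monomials as a basis of `A`, and the induced basis of `F`. -/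

section Standard

variable {K : Type w} {V : Type u} [Field K] [Quiver.{v} V] [Fintype V]
variable {A : Type*} [Ring A] [Algebra K A] {ψ : PathAlgebra K V →ₐ[K] A}
variable [LinearOrder (Mon V)]

theorem exists_isLead {p : PathAlgebra K V} (hp : p ≠ 0) : ∃ b, IsLead p b := by
  have hne : p.support.Nonempty := by
    by_contra h
    rw [Finset.not_nonempty_iff_eq_empty] at h
    exact hp (by rw [← sum_coeff_mon p, h, Finset.sum_empty])
  exact ⟨p.support.max' hne, mem_support.mp (p.support.max'_mem hne),
    fun c hc => p.support.le_max' c (mem_support.mpr hc)⟩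

theorem IsBasicPresentation.map_mon_eq_zero (hψ : IsBasicPresentation ψ) :
    ∃ N : ℕ, ∀ b : Mon V, N ≤ b.deg → ψ (mon K b) = 0 := by
  classical
  obtain ⟨N, hN⟩ := hψ.le_ker
  refine ⟨N, fun b hb => hN _ fun c hc => ?_⟩
  rw [coeff_mon] at hc
  split_ifs at hc with h
  · exact h ▸ hb
  · exact absurd rfl hc

theorem IsStd.map_mon_ne_zero {b : Mon V} (hb : IsStd ψ b) : ψ (mon K b) ≠ 0 :=
  fun h => hb _ h (isLead_mon b)

theorem IsBasicPresentation.finite_isStd [∀ a b : V, Finite (a ⟶ b)]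
    (hψ : IsBasicPresentation ψ) : {b : Mon V | IsStd ψ b}.Finite := by
  obtain ⟨N, hN⟩ := hψ.map_mon_eq_zero
  refine (Mon.finite_deg_lt (V := V) N).subset fun b hb => ?_
  by_contra h
  exact IsStd.map_mon_ne_zero hb (hN b (not_lt.mp h))

/-- If `b` led an element `p` of the kernel, then `d` would lead `p * mon K c`, which is again in
the kernel. -/
theorem IsStd.of_mul_left (hV : IsMonomialOrder V) {b c d : Mon V} (h : b.mul c = some d)
    (hd : IsStd ψ d) : IsStd ψ b := by
  intro p hp hb
  refine hd (p * mon K c) (by rw [map_mul, hp, zero_mul]) ⟨?_, fun d' hd' => ?_⟩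
  · rw [coeff_mul_mon h]; exact hb.1
  · obtain ⟨b', hb', hbd'⟩ := exists_of_coeff_mul_mon_ne_zero hd'
    rcases (hb.2 b' hb').eq_or_lt with rfl | hlt
    · rw [h] at hbd'; exact (Option.some.inj hbd').ge
    · exact (hV.mul_right b b' c d d' hlt h hbd').le

/-- A nontrivial relation lifts to a nonzero element of the kernel all of whose monomials, in
particular the leading one, are standard. -/
theorem linearIndependent_map_mon_isStd :
    LinearIndependent K (fun b : {b : Mon V // IsStd ψ b} => ψ (mon K b.1)) := by
  classical
  rw [linearIndependent_iff']
  intro s g hg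
  by_contra! hne
  obtain ⟨i, hi, hgi⟩ := hne
  have key : ∀ c, (∑ i ∈ s, g i • mon K i.1).coeff c ≠ 0 → ∃ j ∈ s, j.1 = c := by
    intro c hc
    rw [coeff_sum] at hc
    obtain ⟨j, hj, hj'⟩ := Finset.exists_ne_zero_of_sum_ne_zero hc
    refine ⟨j, hj, ?_⟩
    by_contra h
    simp [coeff_mon, h] at hj'
  have hp : (∑ i ∈ s, g i • mon K i.1) ≠ 0 := by
    intro h0
    have := congrArg (fun p => p.coeff i.1) h0
    simp only [coeff_sum, coeff_smul, coeff_mon, coeff_zero, Subtype.coe_inj, mul_ite, mul_one,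
      mul_zero, Finset.sum_ite_eq', hi, if_true] at this
    exact hgi this
  obtain ⟨b, hb⟩ := exists_isLead hp
  obtain ⟨j, -, rfl⟩ := key b hb.1
  exact j.2 _ (by rw [← hg]; simp) hb

theorem map_mon_mem_span_isStd [∀ a b : V, Finite (a ⟶ b)] (hψ : IsBasicPresentation ψ)
    (b : Mon V) :
    ψ (mon K b) ∈ Submodule.span K
      (Set.range (fun b : {b : Mon V // IsStd ψ b} => ψ (mon K b.1))) := by
  obtain ⟨N, hN⟩ := hψ.map_mon_eq_zero
  -- The ordering of all paths need not be well-founded; on the finitely many paths of length below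
  -- `N` it is, and all others map to zero.
  have hwf := (Mon.finite_deg_lt (V := V) N).wellFoundedOn (r := fun x y => x < y)
  by_cases hb : b.deg < N
  swap
  · rw [hN b (not_lt.mp hb)]; exact Submodule.zero_mem _
  refine hwf.induction (P := fun b => ψ (mon K b) ∈ _) hb fun b hb ih => ?_
  by_cases hs : IsStd ψ b
  · exact Submodule.subset_span ⟨⟨b, hs⟩, rfl⟩
  simp only [IsStd, not_forall, not_not] at hs
  obtain ⟨p, hp, hpb⟩ := hs
  have e := map_eq_sum ψ p
  rw [hp, ← Finset.add_sum_erase _ _ (mem_support.mpr hpb.1)] at e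
  have : ψ (mon K b) =
      (p.coeff b)⁻¹ • -∑ c ∈ p.support.erase b, p.coeff c • ψ (mon K c) := by
    rw [eq_inv_smul_iff₀ hpb.1]
    exact eq_neg_of_add_eq_zero_left e.symm
  rw [this]
  refine Submodule.smul_mem _ _ (Submodule.neg_mem _ (Submodule.sum_mem _ fun c hc => ?_))
  rw [Finset.mem_erase, mem_support] at hc
  refine Submodule.smul_mem _ _ ?_
  by_cases hcN : c.deg < N
  · exact ih c hcN (lt_of_le_of_ne (hpb.2 c hc.2) hc.1)
  · rw [hN c (not_lt.mp hcN)]; exact Submodule.zero_mem _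

/-- The basis of `A` formed by the standard monomials. -/
noncomputable def stdBasis [∀ a b : V, Finite (a ⟶ b)] (hψ : IsBasicPresentation ψ) :
    Module.Basis {b : Mon V // IsStd ψ b} K A :=
  Module.Basis.mk linearIndependent_map_mon_isStd (by
    intro a _
    obtain ⟨p, rfl⟩ := hψ.surjective a
    rw [map_eq_sum]
    exact Submodule.sum_mem _ fun b _ => Submodule.smul_mem _ _ (map_mon_mem_span_isStd hψ b))

variable [∀ a b : V, Finite (a ⟶ b)] (hψ : IsBasicPresentation ψ)

theorem stdBasis_apply (b : {b : Mon V // IsStd ψ b}) : stdBasis hψ b = ψ (mon K b.1) := by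
  simp [stdBasis]

/-- Turns the lifts quantified over in `IsLeadA` and `IsLeadF` into coordinates, so that leading
monomials do not depend on a choice. -/
theorem stdBasis_repr {p : PathAlgebra K V} (hp : ∀ c, p.coeff c ≠ 0 → IsStd ψ c)
    (b : {b : Mon V // IsStd ψ b}) : (stdBasis hψ).repr (ψ p) b = p.coeff b.1 := by
  classical
  have e : ψ p = ∑ c ∈ p.support.attach, p.coeff c.1 •
      stdBasis hψ ⟨c.1, hp c.1 (mem_support.mp c.2)⟩ := by
    rw [map_eq_sum, ← Finset.sum_attach]
    simp only [stdBasis_apply]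
  rw [e, map_sum, Finsupp.finsetSum_apply]
  simp only [map_smul, Module.Basis.repr_self, Finsupp.smul_apply, Finsupp.single_apply,
    smul_eq_mul, mul_ite, mul_one, mul_zero]
  by_cases hb : b.1 ∈ p.support
  · rw [Finset.sum_eq_single ⟨b.1, hb⟩]
    · simp
    · intro c _ hc
      rw [if_neg]
      rintro rfl
      exact hc rfl
    · simp
  · rw [Finset.sum_eq_zero, not_not.mp (mt mem_support.mpr hb)]
    intro c _
    rw [if_neg]
    rintro rfl
    exact hb c.2

theorem exists_standard_lift (hψ : IsBasicPresentation ψ) (a : A) :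
    ∃ p : PathAlgebra K V, ψ p = a ∧ ∀ c, p.coeff c ≠ 0 → IsStd ψ c := by
  classical
  refine ⟨∑ b ∈ ((stdBasis hψ).repr a).support, (stdBasis hψ).repr a b • mon K b.1, ?_, ?_⟩
  · conv_rhs => rw [← (stdBasis hψ).linearCombination_repr a]
    simp [Finsupp.linearCombination_apply, Finsupp.sum, stdBasis_apply]
  · intro c hc
    rw [coeff_sum] at hc
    obtain ⟨j, hj, hj'⟩ := Finset.exists_ne_zero_of_sum_ne_zero hc
    by_cases h : j.1 = c
    · exact h ▸ j.2
    · simp [coeff_mon, h] at hj'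

theorem isLeadA_iff (a : A) (b : {b : Mon V // IsStd ψ b}) :
    IsLeadA ψ a b.1 ↔ (stdBasis hψ).repr a b ≠ 0 ∧
      ∀ c, (stdBasis hψ).repr a c ≠ 0 → c.1 ≤ b.1 := by
  constructor
  · rintro ⟨p, rfl, hp, h0, hle⟩
    simp only [stdBasis_repr hψ hp]
    exact ⟨h0, fun c hc => hle c.1 hc⟩
  · intro h
    obtain ⟨p, rfl, hp⟩ := exists_standard_lift hψ a
    simp only [stdBasis_repr hψ hp] at h
    exact ⟨p, rfl, hp, h.1, fun c hc => h.2 ⟨c, hp c hc⟩ hc⟩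

/-- The monomials of `F` as pairs of an index and a standard monomial. -/
def FMon.equivSigma (ψ : PathAlgebra K V →ₐ[K] A) (r : ℕ) :
    (Σ _ : Fin r, {b : Mon V // IsStd ψ b}) ≃ FMon ψ r where
  toFun x := ⟨x.1, x.2.1, x.2.2⟩
  invFun t := ⟨t.idx, t.mon, t.std⟩
  left_inv _ := rfl
  right_inv _ := rfl

theorem FMon.finite (hψ : IsBasicPresentation ψ) (r : ℕ) : Finite (FMon ψ r) := by
  have : Finite {b : Mon V // IsStd ψ b} := hψ.finite_isStd
  exact Finite.of_equiv _ (FMon.equivSigma ψ r)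

/-- The monomial basis of the free module `F`. -/
noncomputable def fBasis (r : ℕ) : Module.Basis (FMon ψ r) K (Fin r → A) :=
  (Pi.basis fun _ : Fin r => stdBasis hψ).reindex (FMon.equivSigma ψ r)

theorem fBasis_repr {r : ℕ} (f : Fin r → A) (t : FMon ψ r) :
    (fBasis hψ r).repr f t = (stdBasis hψ).repr (f t.idx) ⟨t.mon, t.std⟩ := by
  rw [fBasis, Module.Basis.repr_reindex_apply, Pi.basis_repr]
  rfl

theorem isLeadF_iff {r : ℕ} [LinearOrder (FMon ψ r)] (f : Fin r → A) (t : FMon ψ r) :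
    IsLeadF ψ f t ↔ (fBasis hψ r).repr f t ≠ 0 ∧
      ∀ u, (fBasis hψ r).repr f u ≠ 0 → u ≤ t := by
  simp only [fBasis_repr]
  constructor
  · rintro ⟨p, hf, hp, h0, hle⟩
    simp only [← hf, stdBasis_repr hψ (hp _)]
    exact ⟨h0, hle⟩
  · intro h
    choose p hp hs using fun i => exists_standard_lift hψ (f i)
    simp only [← hp, stdBasis_repr hψ (hs _)] at h
    exact ⟨p, hp, hs, h⟩

end Standard

/-! ### Triangularity: linear algebra with leading indices. -/

section LeadingTerms

variable {K ι W : Type*} [Field K] [AddCommGroup W] [Module K W] [LinearOrder ι]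

/-- `t` is the greatest index that occurs in the expansion of `f` in the basis `b`. -/
def IsLeadIndex (b : Module.Basis ι K W) (f : W) (t : ι) : Prop :=
  b.repr f t ≠ 0 ∧ ∀ u, b.repr f u ≠ 0 → u ≤ t

variable {b : Module.Basis ι K W}

theorem IsLeadIndex.unique {f : W} {t t' : ι} (h : IsLeadIndex b f t) (h' : IsLeadIndex b f t') :
    t = t' :=
  le_antisymm (h'.2 t h.1) (h.2 t' h'.1)

theorem IsLeadIndex.ne_zero {f : W} {t : ι} (h : IsLeadIndex b f t) : f ≠ 0 := by
  rintro rfl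
  exact h.1 (by simp)

theorem exists_isLeadIndex (b : Module.Basis ι K W) {f : W} (hf : f ≠ 0) :
    ∃ t, IsLeadIndex b f t := by
  have hne : (b.repr f).support.Nonempty := by
    rw [Finsupp.support_nonempty_iff]
    simpa using hf
  exact ⟨_, Finsupp.mem_support_iff.mp ((b.repr f).support.max'_mem hne),
    fun u hu => (b.repr f).support.le_max' u (Finsupp.mem_support_iff.mpr hu)⟩

/-- In a relation, the greatest leading index among the terms with nonzero coefficient belongs to
one term only and cannot cancel. -/
theorem linearIndependent_of_isLeadIndex {B : Set W} (h0 : (0 : W) ∉ B)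
    (hB : ∀ f ∈ B, ∀ g ∈ B, ∀ t, IsLeadIndex b f t → IsLeadIndex b g t → f = g) :
    LinearIndependent K ((↑) : B → W) := by
  classical
  choose L hL using fun f : B => exists_isLeadIndex b (f := f.1) fun h => h0 (h ▸ f.2)
  rw [linearIndependent_iff']
  intro s g hg
  by_contra! hne
  obtain ⟨i, hi, hgi⟩ := hne
  obtain ⟨j, hj, hmax⟩ := (s.filter fun i => g i ≠ 0).exists_max_image (fun f => L f)
    ⟨i, by simp [hi, hgi]⟩
  rw [Finset.mem_filter] at hj
  have e := congrArg (fun f => b.repr f (L j)) hg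
  simp only [map_sum, map_smul, Finsupp.finsetSum_apply, Finsupp.smul_apply, smul_eq_mul,
    map_zero, Finsupp.zero_apply] at e
  rw [Finset.sum_eq_single j] at e
  · exact (mul_ne_zero hj.2 (hL j).1) e
  · intro k hk hkj
    by_contra hne
    have hgk := left_ne_zero_of_mul hne
    have h1 := (hL k).2 _ (right_ne_zero_of_mul hne)
    have h2 := hmax k (by simp [hk, hgk])
    have h3 := hL k
    rw [le_antisymm h2 h1] at h3
    exact hkj (Subtype.ext (hB _ k.2 _ j.2 _ h3 (hL j)))
  · exact fun h => absurd hj.1 h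

/-- Subtracting a multiple of the element of `B` with the same leading index lowers the leading
index; finiteness of `ι` ends the process. -/
theorem le_span_of_isLeadIndex [Finite ι] {B : Set W} {S : Submodule K W} (hBS : B ⊆ S)
    (hB : ∀ f ∈ S, ∀ t, IsLeadIndex b f t → ∃ g ∈ B, IsLeadIndex b g t) :
    S ≤ Submodule.span K B := by
  have key : ∀ t, ∀ f ∈ S, IsLeadIndex b f t → f ∈ Submodule.span K B := by
    intro t
    induction t using WellFoundedLT.induction with
    | _ t ih =>
    intro f hf hft
    obtain ⟨g, hg, hgt⟩ := hB f hf t hft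
    set a := b.repr f t / b.repr g t
    have hsum : f = (f - a • g) + a • g := by abel
    rw [hsum]
    refine Submodule.add_mem _ ?_ (Submodule.smul_mem _ _ (Submodule.subset_span hg))
    by_cases h0 : f - a • g = 0
    · rw [h0]; exact Submodule.zero_mem _
    obtain ⟨u, hu⟩ := exists_isLeadIndex b h0
    refine ih u ?_ _ (S.sub_mem hf (S.smul_mem _ (hBS hg))) hu
    have hu0 := hu.1
    simp only [map_sub, map_smul, Finsupp.sub_apply, Finsupp.smul_apply, smul_eq_mul] at hu0
    refine lt_of_le_of_ne ?_ ?_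
    · by_cases hfu : b.repr f u = 0
      · refine hgt.2 u fun hgu => hu0 ?_
        rw [hfu, hgu]; simp
      · exact hft.2 u hfu
    · rintro rfl
      refine hu0 ?_
      rw [div_mul_cancel₀ _ hgt.1, sub_self]
  intro f hf
  by_cases h0 : f = 0
  · rw [h0]; exact Submodule.zero_mem _
  · obtain ⟨t, ht⟩ := exists_isLeadIndex b h0
    exact key t f hf ht

end LeadingTerms

section RightMul

variable {K A : Type*} [Field K] [Ring A] [Algebra K A]

theorem op_smul_smul_comm {r : ℕ} (a : A) (k : K) (f : Fin r → A) :
    op a • k • f = k • op a • f := by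
  funext i
  simp

/-- Right multiplication by an element of `A` on the free module, as a `K`-linear map. -/
def rightMul (K : Type*) {A : Type*} [Field K] [Ring A] [Algebra K A] (r : ℕ) (a : A) :
    (Fin r → A) →ₗ[K] (Fin r → A) where
  toFun f := op a • f
  map_add' f g := smul_add _ f g
  map_smul' k f := op_smul_smul_comm a k f

theorem rightMul_apply {r : ℕ} (a : A) (f : Fin r → A) : rightMul K r a f = op a • f := rfl

end RightMul

/-! ### Leading monomials of `F` under multiplication by small cofactors. -/

section ModuleF

variable {K : Type w} {V : Type u} [Field K] [Quiver.{v} V] [Fintype V]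
variable {A : Type*} [Ring A] [Algebra K A] {ψ : PathAlgebra K V →ₐ[K] A}
variable [LinearOrder (Mon V)] [∀ a b : V, Finite (a ⟶ b)]

theorem fBasis_apply (hψ : IsBasicPresentation ψ) {r : ℕ} (t : FMon ψ r) :
    fBasis hψ r t = Pi.single t.idx (ψ (mon K t.mon)) := by
  rw [fBasis, Module.Basis.reindex_apply, Pi.basis_apply, stdBasis_apply]
  rfl

variable {r : ℕ} [LinearOrder (FMon ψ r)]

theorem isLeadF_iff_isLeadIndex (hψ : IsBasicPresentation ψ) (f : Fin r → A) (t : FMon ψ r) :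
    IsLeadF ψ f t ↔ IsLeadIndex (fBasis hψ r) f t :=
  isLeadF_iff hψ f t

theorem IsLeadF.unique (hψ : IsBasicPresentation ψ) {f : Fin r → A} {t t' : FMon ψ r}
    (h : IsLeadF ψ f t) (h' : IsLeadF ψ f t') : t = t' := by
  simp only [isLeadF_iff_isLeadIndex hψ] at h h'
  exact h.unique h'

theorem IsLeadF.ne_zero (hψ : IsBasicPresentation ψ) {f : Fin r → A} {t : FMon ψ r}
    (h : IsLeadF ψ f t) : f ≠ 0 := by
  rw [isLeadF_iff_isLeadIndex hψ] at h
  exact IsLeadIndex.ne_zero h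

/-- The axiom `mul_right` bounds only the leading monomial of the product; `compat` extends the
bound to its other monomials, which have the same index. -/
theorem lt_of_repr_mul_ne_zero (hψ : IsBasicPresentation ψ) (hF : IsMonomialOrderF ψ r)
    {t u : FMon ψ r} {c d : Mon V} (hc : IsSmallCofactor ψ t.mon c d) (hu : u < t) {x : FMon ψ r}
    (hx : (fBasis hψ r).repr (op (ψ (mon K c)) • fBasis hψ r u) x ≠ 0) :
    x < ⟨t.idx, d, hc.2.2.2⟩ := by
  have e : (op (ψ (mon K c)) • fBasis hψ r u) =
      Pi.single u.idx (ψ (mon K u.mon) * ψ (mon K c)) := by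
    rw [fBasis_apply]
    funext i
    by_cases h : i = u.idx
    · subst h; simp
    · simp [h]
  rw [e, fBasis_repr] at hx
  have hi : x.idx = u.idx := by
    by_contra h
    simp [h] at hx
  rw [hi, Pi.single_eq_same] at hx
  have hne : ψ (mon K u.mon) * ψ (mon K c) ≠ 0 := by
    intro h
    simp [h] at hx
  obtain ⟨y, hy⟩ := exists_isLeadIndex (stdBasis hψ) hne
  have hlt : (⟨u.idx, y.1, y.2⟩ : FMon ψ r) < ⟨t.idx, d, hc.2.2.2⟩ :=
    hF.mul_right t u c _ _ hu rfl hc rfl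
      ((isLeadA_iff hψ _ _).mpr ⟨hy.1, fun c hc => hy.2 c hc⟩)
  refine lt_of_le_of_lt ?_ hlt
  have hle : x.mon ≤ y.1 := hy.2 _ hx
  rcases hle.eq_or_lt with h | h
  · exact le_of_eq (FMon.ext hi h)
  · exact (hF.compat ⟨u.idx, y.1, y.2⟩ x hi.symm h).le

/-- Multiplication by a small cofactor of the leading monomial multiplies the leading monomial. -/
theorem IsLeadF.op_smul (hψ : IsBasicPresentation ψ) (hF : IsMonomialOrderF ψ r)
    {f : Fin r → A} {t : FMon ψ r} (hf : IsLeadF ψ f t) {c d : Mon V}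
    (hc : IsSmallCofactor ψ t.mon c d) :
    IsLeadF ψ (op (ψ (mon K c)) • f) ⟨t.idx, d, hc.2.2.2⟩ := by
  classical
  rw [isLeadF_iff_isLeadIndex hψ] at hf ⊢
  set b := fBasis hψ r with hb
  set t' : FMon ψ r := ⟨t.idx, d, hc.2.2.2⟩ with ht'
  have ht : op (ψ (mon K c)) • b t = b t' := by
    rw [hb, fBasis_apply, fBasis_apply]
    funext i
    by_cases h : i = t.idx
    · subst h
      simp only [Pi.smul_apply, Pi.single_eq_same, op_smul_eq_mul, ht', ← map_mul,
        mon_mul_mon_of_eq_some hc.2.2.1]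
    · simp [h, ht']
  have hmul : ∀ x, b.repr (op (ψ (mon K c)) • f) x =
      ∑ u ∈ (b.repr f).support, b.repr f u * b.repr (op (ψ (mon K c)) • b u) x := by
    intro x
    have e : op (ψ (mon K c)) • f =
        ∑ u ∈ (b.repr f).support, b.repr f u • op (ψ (mon K c)) • b u := by
      conv_lhs => rw [← b.linearCombination_repr f, ← rightMul_apply (K := K)]
      rw [Finsupp.linearCombination_apply, Finsupp.sum, map_sum]
      simp [rightMul_apply]
    rw [e]
    simp
  have hlt : ∀ u ∈ (b.repr f).support, u ≠ t → ∀ x,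
      b.repr (op (ψ (mon K c)) • b u) x ≠ 0 → x < t' := fun u hu hne x hx =>
    lt_of_repr_mul_ne_zero hψ hF hc
      (lt_of_le_of_ne (hf.2 u (Finsupp.mem_support_iff.mp hu)) hne) hx
  constructor
  · rw [hmul, Finset.sum_eq_single t]
    · rw [ht]
      simpa using hf.1
    · intro u hu hne
      by_contra h
      exact (hlt u hu hne t' (right_ne_zero_of_mul h)).false
    · intro h
      exact absurd (Finsupp.mem_support_iff.mpr hf.1) h
  · intro x hx
    rw [hmul] at hx
    obtain ⟨u, hu, hne⟩ := Finset.exists_ne_zero_of_sum_ne_zero hx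
    have h := right_ne_zero_of_mul hne
    by_cases hut : u = t
    · rw [hut, ht, Module.Basis.repr_self, Finsupp.single_apply] at h
      split_ifs at h with h'
      · exact h'.ge
      · exact absurd rfl h
    · exact (hlt u hu hut x h).le

end ModuleF

theorem EMon.mul_eq_some {m : ℕ} {V : Type u} [Quiver.{v} V] {s t : EMon m V} {c : Mon V} :
    s.mul c = some t ↔ s.idx = t.idx ∧ s.mon.mul c = some t.mon := by
  simp only [EMon.mul, Option.map_eq_some_iff]
  constructor
  · rintro ⟨b, hb, rfl⟩
    exact ⟨rfl, hb⟩
  · rintro ⟨h, h'⟩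
    exact ⟨t.mon, h', EMon.ext h rfl⟩

theorem EMon.deg_mul {m : ℕ} {V : Type u} [Quiver.{v} V] {s t : EMon m V} {c : Mon V} (h : s.mul c = some t) :
    t.deg = s.deg + c.deg :=
  Mon.deg_mul (EMon.mul_eq_some.mp h).2

/-! ### Images in `F` of sets of monomials of `E`. -/

section Evaluation

variable {K : Type w} {V : Type u} [Field K] [Quiver.{v} V] [Fintype V]
variable {A : Type*} [Ring A] [Algebra K A] (ψ : PathAlgebra K V →ₐ[K] A)
variable {m r : ℕ} (ghat : Fin m → Fin r → A)

/-- The evaluation of a monomial of `E`. -/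
noncomputable def evMon (s : EMon m V) : Fin r → A := op (ψ (mon K s.mon)) • ghat s.idx

/-- The span of the evaluations of the monomials in `D`. -/
noncomputable def evSpan (D : Set (EMon m V)) : Submodule K (Fin r → A) :=
  Submodule.span K (evMon ψ ghat '' D)

variable {ψ ghat}

theorem evMon_mem_evSpan {D : Set (EMon m V)} {s : EMon m V} (hs : s ∈ D) :
    evMon ψ ghat s ∈ evSpan ψ ghat D :=
  Submodule.subset_span ⟨s, hs, rfl⟩

theorem evSpan_mono {D D' : Set (EMon m V)} (h : D ⊆ D') :
    evSpan ψ ghat D ≤ evSpan ψ ghat D' :=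
  Submodule.span_mono (Set.image_mono h)

theorem ev_add (f f' : Fin m → PathAlgebra K V) :
    ev ψ ghat (f + f') = ev ψ ghat f + ev ψ ghat f' := by
  simp [ev, add_smul, Finset.sum_add_distrib]

theorem ev_smul (a : K) (f : Fin m → PathAlgebra K V) :
    ev ψ ghat (a • f) = a • ev ψ ghat f := by
  simp only [ev, Pi.smul_apply, map_smul, op_smul, Finset.smul_sum, smul_assoc]

theorem ev_zero : ev ψ ghat (0 : Fin m → PathAlgebra K V) = 0 := by
  simp [ev]

theorem ev_single (s : EMon m V) :
    ev ψ ghat (Pi.single s.idx (mon K s.mon)) = evMon ψ ghat s := by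
  rw [ev, Finset.sum_eq_single s.idx]
  · simp [evMon]
  · intro i _ h
    simp [h]
  · simp

theorem coeff_single_mon (s t : EMon m V) [Decidable (s = t)] :
    ((Pi.single s.idx (mon K s.mon) : Fin m → PathAlgebra K V) t.idx).coeff t.mon =
      if s = t then 1 else 0 := by
  classical
  by_cases h : t.idx = s.idx
  · rw [h, Pi.single_eq_same, coeff_mon]
    congr 1
    rw [EMon.ext_iff]
    simp [h]
  · rw [Pi.single_eq_of_ne h, if_neg (fun e => h (by rw [e])), coeff_zero]

theorem ev_mem_evSpan {D : Set (EMon m V)} {f : Fin m → PathAlgebra K V}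
    (hf : ∀ s : EMon m V, (f s.idx).coeff s.mon ≠ 0 → s ∈ D) :
    ev ψ ghat f ∈ evSpan ψ ghat D := by
  refine Submodule.sum_mem _ fun i _ => ?_
  rw [map_eq_sum, Finset.op_sum, Finset.sum_smul]
  refine Submodule.sum_mem _ fun b hb => ?_
  rw [op_smul, smul_assoc]
  exact Submodule.smul_mem _ _
    (evMon_mem_evSpan (s := ⟨i, b⟩) (hf ⟨i, b⟩ (mem_support.mp hb)))

theorem exists_ev_of_mem_evSpan {D : Set (EMon m V)} {x : Fin r → A}
    (hx : x ∈ evSpan ψ ghat D) :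
    ∃ f : Fin m → PathAlgebra K V, ev ψ ghat f = x ∧
      ∀ s : EMon m V, (f s.idx).coeff s.mon ≠ 0 → s ∈ D := by
  classical
  induction hx using Submodule.span_induction with
  | mem x hx =>
    obtain ⟨s, hs, rfl⟩ := hx
    refine ⟨_, ev_single s, fun t ht => ?_⟩
    rw [coeff_single_mon] at ht
    split_ifs at ht with h
    · exact h ▸ hs
    · exact absurd rfl ht
  | zero => exact ⟨0, ev_zero, fun s hs => absurd rfl hs⟩
  | add x y _ _ hx hy =>
    obtain ⟨f, rfl, hf⟩ := hx
    obtain ⟨g, rfl, hg⟩ := hy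
    refine ⟨f + g, ev_add f g, fun s hs => ?_⟩
    by_contra h
    have h1 := not_not.mp (mt (hf s) h)
    have h2 := not_not.mp (mt (hg s) h)
    exact hs (by rw [Pi.add_apply, coeff_add, h1, h2, add_zero])
  | smul a x _ hx =>
    obtain ⟨f, rfl, hf⟩ := hx
    refine ⟨a • f, ev_smul a f, fun s hs => hf s fun h => hs ?_⟩
    rw [Pi.smul_apply, coeff_smul, h, mul_zero]

theorem op_smul_evMon {s : EMon m V} {c : Mon V} :
    op (ψ (mon K c)) • evMon ψ ghat s = (s.mul c).elim 0 (evMon ψ ghat) := by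
  rw [evMon, smul_smul, ← op_mul, ← map_mul]
  cases h : s.mon.mul c with
  | none => simp [EMon.mul, mon_mul_mon_of_eq_none h, h]
  | some d => simp [EMon.mul, mon_mul_mon_of_eq_some h, h, evMon]

theorem op_smul_mem_evSpan {D D' : Set (EMon m V)} {c : Mon V}
    (h : ∀ s ∈ D, ∀ t, s.mul c = some t → t ∈ D') {x : Fin r → A} (hx : x ∈ evSpan ψ ghat D) :
    op (ψ (mon K c)) • x ∈ evSpan ψ ghat D' := by
  suffices evSpan ψ ghat D ≤ (evSpan ψ ghat D').comap (rightMul K r (ψ (mon K c))) from this hx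
  refine Submodule.span_le.mpr ?_
  rintro _ ⟨s, hs, rfl⟩
  change op (ψ (mon K c)) • evMon ψ ghat s ∈ evSpan ψ ghat D'
  rw [op_smul_evMon]
  cases ht : s.mul c with
  | none => exact Submodule.zero_mem _
  | some t => exact evMon_mem_evSpan (h s hs t ht)

/-- An element involves only finitely many monomials of `D`, so a greatest one exists even when `D`
itself has none. This is what makes `Set.Iio q` usable. -/
theorem eq_zero_or_exists_mem_evSpan_Iic [LinearOrder (EMon m V)] {D : Set (EMon m V)}
    {x : Fin r → A} (hx : x ∈ evSpan ψ ghat D) :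
    x = 0 ∨ ∃ q ∈ D, x ∈ evSpan ψ ghat (Set.Iic q) := by
  induction hx using Submodule.span_induction with
  | mem x hx =>
    obtain ⟨s, hs, rfl⟩ := hx
    exact Or.inr ⟨s, hs, evMon_mem_evSpan (Set.mem_Iic.mpr le_rfl)⟩
  | zero => exact Or.inl rfl
  | add x y _ _ hx hy =>
    rcases hx with rfl | ⟨q, hq, hx⟩
    · rwa [zero_add]
    rcases hy with rfl | ⟨q', hq', hy⟩
    · rw [add_zero]; exact Or.inr ⟨q, hq, hx⟩
    refine Or.inr ⟨max q q', ?_, Submodule.add_mem _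
      (evSpan_mono (Set.Iic_subset_Iic.mpr (le_max_left _ _)) hx)
      (evSpan_mono (Set.Iic_subset_Iic.mpr (le_max_right _ _)) hy)⟩
    rcases max_choice q q' with h | h <;> rw [h] <;> assumption
  | smul a x _ hx =>
    rcases hx with rfl | ⟨q, hq, hx⟩
    · exact Or.inl (smul_zero a)
    · exact Or.inr ⟨q, hq, Submodule.smul_mem _ _ hx⟩

end Evaluation

/-! ### Negative degree orderings. -/

section DegreeOrder

variable {m : ℕ} {V : Type u} [Quiver.{v} V]

theorem EMon.finite_deg_lt [Finite V] [∀ a b : V, Finite (a ⟶ b)] (n : ℕ) :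
    {s : EMon m V | s.deg < n}.Finite := by
  refine ((Set.finite_univ (α := Fin m)).prod (Mon.finite_deg_lt (V := V) n)).image
    (fun x => (⟨x.1, x.2⟩ : EMon m V)) |>.subset fun s hs => ?_
  exact ⟨(s.idx, s.mon), ⟨trivial, hs⟩, rfl⟩

theorem EMon.exists_prefix (s : EMon m V) {k : ℕ} (hk : k ≤ s.deg) :
    ∃ (t : EMon m V) (e : Mon V), t.deg = k ∧ t.mul e = some s := by
  obtain ⟨c, e, hc, he⟩ := s.mon.exists_prefix hk
  exact ⟨⟨s.idx, c⟩, e, hc, EMon.mul_eq_some.mpr ⟨rfl, he⟩⟩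

variable [LinearOrder (EMon m V)]

theorem IsNegDegOrderE.deg_le (hneg : IsNegDegOrderE m V) {s t : EMon m V} (h : s ≤ t) :
    t.deg ≤ s.deg := by
  by_contra! hlt
  exact (hneg t s hlt).not_ge h

/-- The value `⊥` needs no separate treatment: a monomial of degree at least `k` has a prefix of
degree exactly `k`, so without the latter both sides are false. -/
theorem IsTopOfDegree.le_iff (hneg : IsNegDegOrderE m V) {k : ℕ} {τ : WithBot (EMon m V)}
    (hτ : IsTopOfDegree k τ) (q : EMon m V) : (q : WithBot (EMon m V)) ≤ τ ↔ k ≤ q.deg := by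
  constructor
  · intro h
    obtain ⟨s, rfl, rfl⟩ := hτ.2 (by rintro rfl; simp at h)
    exact hneg.deg_le (WithBot.coe_le_coe.mp h)
  · intro h
    obtain ⟨s, e, hs, he⟩ := q.exists_prefix h
    refine le_trans (WithBot.coe_le_coe.mpr ?_) (hτ.1 s hs)
    rcases h.eq_or_lt with h | h
    -- In equal degree the cofactor is a trivial path, so the prefix is `q` itself; the degree
    -- ordering alone would not compare them.
    · have he0 : e.deg = 0 := by
        have := EMon.deg_mul he
        omega
      obtain ⟨a, rfl⟩ := Mon.deg_eq_zero he0
      obtain ⟨hi, hm⟩ := EMon.mul_eq_some.mp he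
      obtain ⟨x, y, z, p, p', h1, h2, h3⟩ := Mon.mul_eq_some hm
      simp only [Mon.triv, Mon.mk.injEq] at h2
      obtain ⟨rfl, rfl, h2⟩ := h2
      cases h2
      exact le_of_eq (EMon.ext hi.symm (by rw [h1, h3]; simp))
    · exact (hneg q s (by omega)).le

end DegreeOrder

/-! ### Signed elements and the filtration by signature. -/

section SignedElements

variable {K : Type w} {V : Type u} [Field K] [Quiver.{v} V] [Fintype V]
variable {A : Type*} [Ring A] [Algebra K A] {ψ : PathAlgebra K V →ₐ[K] A}
variable {m r : ℕ} [LinearOrder (EMon m V)] {ghat : Fin m → Fin r → A}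

theorem IsSigned.mem_evSpan {x : (Fin r → A) × EMon m V} (hx : IsSigned ψ ghat x) :
    x.1 ∈ evSpan ψ ghat (Set.Iic x.2) := by
  obtain ⟨f, hf, hfx⟩ := hx
  rw [← hfx]
  exact ev_mem_evSpan hf.2

/-- An element whose expression needs the monomial `q` has signature `q`. -/
theorem isSigned_of_mem_evSpan {x : Fin r → A} {q : EMon m V}
    (hx : x ∈ evSpan ψ ghat (Set.Iic q)) (hx' : x ∉ evSpan ψ ghat (Set.Iio q)) :
    IsSigned ψ ghat (x, q) := by
  obtain ⟨f, rfl, hf⟩ := exists_ev_of_mem_evSpan hx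
  refine ⟨f, ⟨fun h0 => hx' (ev_mem_evSpan fun s hs => ?_), hf⟩, rfl⟩
  refine lt_of_le_of_ne (hf s hs) ?_
  rintro rfl
  exact hs h0

theorem IsSigned.op_smul_mem_evSpan [LinearOrder (Mon V)] (hE : IsMonomialOrderE m V) {x : (Fin r → A) × EMon m V}
    (hx : IsSigned ψ ghat x) {c : Mon V} {q : EMon m V} (hq : x.2.mul c = some q) :
    op (ψ (mon K c)) • x.1 ∈ evSpan ψ ghat (Set.Iic q) := by
  refine SignedStd.op_smul_mem_evSpan (fun s hs t ht => ?_) hx.mem_evSpan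
  rcases (Set.mem_Iic.mp hs).eq_or_lt with rfl | hlt
  · rw [hq] at ht
    exact (Option.some.inj ht).ge
  · exact (hE.mul_right _ _ c _ _ hlt hq ht).le

end SignedElements

/-! ### New leading monomials and the signed standard basis. -/

section Signatures

variable {K : Type w} {V : Type u} [Field K] [Quiver.{v} V] [Fintype V]
variable {A : Type*} [Ring A] [Algebra K A] {ψ : PathAlgebra K V →ₐ[K] A}
variable [LinearOrder (Mon V)] {m r : ℕ} [LinearOrder (EMon m V)] [LinearOrder (FMon ψ r)]
variable {ghat : Fin m → Fin r → A}

/-- The monomial `t` is the leading monomial of an element of signature at most `q`, but not of an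
element of smaller signature. -/
def IsNewLead (ghat : Fin m → Fin r → A) (t : FMon ψ r) (q : EMon m V) : Prop :=
  (∃ f ∈ evSpan ψ ghat (Set.Iic q), IsLeadF ψ f t) ∧
    ∀ f ∈ evSpan ψ ghat (Set.Iio q), ¬ IsLeadF ψ f t

/-- For `q < q'`, a witness at `q` already lies strictly below `q'`. -/
theorem IsNewLead.unique {t : FMon ψ r} {q q' : EMon m V} (h : IsNewLead ghat t q)
    (h' : IsNewLead ghat t q') : q = q' := by
  rcases lt_trichotomy q q' with hlt | rfl | hlt
  · obtain ⟨f, hf, hft⟩ := h.1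
    exact absurd hft (h'.2 f (evSpan_mono (Set.Iic_subset_Iio.mpr hlt) hf))
  · rfl
  · obtain ⟨f, hf, hft⟩ := h'.1
    exact absurd hft (h.2 f (evSpan_mono (Set.Iic_subset_Iio.mpr hlt) hf))

/-- Two elements of an interreduced set with multiples that agree in leading monomial and
signature are equal, together with the cofactors. -/
theorem IsInterreduced.eq_of_mul_eq (hV : IsMonomialOrder V)
    {G : Set ((Fin r → A) × EMon m V)} (hGred : IsInterreduced ψ G)
    {g g' : (Fin r → A) × EMon m V} (hg : g ∈ G) (hg' : g' ∈ G) {t t' : FMon ψ r}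
    (ht : IsLeadF ψ g.1 t) (ht' : IsLeadF ψ g'.1 t') (hi : t.idx = t'.idx) {c c' d : Mon V}
    (hc : IsSmallCofactor ψ t.mon c d) (hc' : IsSmallCofactor ψ t'.mon c' d) {q : EMon m V}
    (hq : g.2.mul c = some q) (hq' : g'.2.mul c' = some q) : g = g' ∧ c = c' := by
  wlog hl : c.deg ≤ c'.deg generalizing g g' t t' c c'
  · have := this hg' hg ht' ht hi.symm hc' hc hq' hq (le_of_not_ge hl)
    exact ⟨this.1.symm, this.2.symm⟩
  rw [EMon.mul_eq_some] at hq hq'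
  obtain ⟨e, he, he'⟩ := Mon.exists_middle hc.2.2.1 hc'.2.2.1 hl
  obtain ⟨e₂, he₂, he₂'⟩ := Mon.exists_middle hq.2 hq'.2 hl
  -- The leading monomials and the signatures are thus related by one and the same path `e`; if `g ≠
  -- g'`, then `g'` with cofactor `e` reaches both `LM g` and the signature of `g`, which
  -- interreducedness forbids.
  obtain rfl := Mon.mul_right_cancel he he₂
  have hgg : g = g' := by
    by_contra hne
    refine (hGred g hg).2 g' hg' (Ne.symm hne) ⟨t', t, e, ht', ht, hi.symm,
      ⟨hc'.1, hc'.2.1.of_mul_left hV he, he', hc.1⟩,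
      EMon.mul_eq_some.mpr ⟨hq'.1.trans hq.1.symm, he₂'⟩⟩
  subst hgg
  exact ⟨rfl, Mon.mul_left_cancel hq.2 hq'.2⟩

variable [∀ a b : V, Finite (a ⟶ b)]

/-- Translates reducibility into the filtration: the reducing multiple of `g` is itself an element
of signature bound `q` with leading monomial `t`. -/
theorem TopReduces.exists_mem_evSpan (hψ : IsBasicPresentation ψ) (hE : IsMonomialOrderE m V)
    (hF : IsMonomialOrderF ψ r) {g : (Fin r → A) × EMon m V} {f : Fin r → A} {q : EMon m V}
    (h : TopReduces ψ g f q) (hg : IsSigned ψ ghat g) {t : FMon ψ r} (ht : IsLeadF ψ f t) :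
    ∃ f' ∈ evSpan ψ ghat (Set.Iic q), IsLeadF ψ f' t := by
  obtain ⟨t₀, u, c, hgt, hfu, hi, hc, hq⟩ := h
  obtain rfl := ht.unique hψ hfu
  refine ⟨_, hg.op_smul_mem_evSpan hE hq, ?_⟩
  have := hgt.op_smul hψ hF hc
  rwa [show (⟨t₀.idx, t.mon, hc.2.2.2⟩ : FMon ψ r) = t from FMon.ext hi rfl] at this

theorem exists_isNewLead (hψ : IsBasicPresentation ψ) (hneg : IsNegDegOrderE m V)
    {t : FMon ψ r} {q : EMon m V} {f : Fin r → A} (hf : f ∈ evSpan ψ ghat (Set.Iic q))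
    (hft : IsLeadF ψ f t) : ∃ q' ≤ q, IsNewLead ghat t q' := by
  obtain ⟨N, hN⟩ := hψ.map_mon_eq_zero
  -- Everything below a monomial of degree at least `N` has degree at least `N` and evaluates to
  -- zero, so only degrees below `N` contribute.
  have hfin : {q : EMon m V | ∃ f ∈ evSpan ψ ghat (Set.Iic q), IsLeadF ψ f t}.Finite := by
    refine (EMon.finite_deg_lt N).subset ?_
    rintro q ⟨f, hf, hft⟩
    by_contra h
    have hbot : evSpan ψ ghat (Set.Iic q) ≤ ⊥ := by
      refine Submodule.span_le.mpr ?_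
      rintro _ ⟨s, hs, rfl⟩
      have hs' : N ≤ s.mon.deg := (not_lt.mp h).trans (hneg.deg_le hs)
      simp [evMon, hN _ hs']
    exact hft.ne_zero hψ ((Submodule.mem_bot K).mp (hbot hf))
  obtain ⟨q', hq', hmin⟩ := hfin.exists_minimal ⟨q, f, hf, hft⟩
  have hle : ∀ q'', (∃ f ∈ evSpan ψ ghat (Set.Iic q''), IsLeadF ψ f t) → q' ≤ q'' :=
    fun q'' h => (le_total q' q'').elim id (fun h' => hmin h h')
  refine ⟨q', hle q ⟨f, hf, hft⟩, hq', fun f hf hft => ?_⟩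
  rcases eq_zero_or_exists_mem_evSpan_Iic hf with rfl | ⟨q'', hlt, hf'⟩
  · exact hft.ne_zero hψ rfl
  · exact (Set.mem_Iio.mp hlt).not_ge (hle q'' ⟨f, hf', hft⟩)

/-- A leading monomial that is new in signature `q` comes from the signed standard basis. -/
theorem IsNewLead.exists_mem (hψ : IsBasicPresentation ψ) (hE : IsMonomialOrderE m V)
    (hF : IsMonomialOrderF ψ r) {G : Set ((Fin r → A) × EMon m V)}
    (hG : IsSignedStandardBasis ψ ghat G) {t : FMon ψ r} {q : EMon m V}
    (h : IsNewLead ghat t q) :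
    ∃ g ∈ G, ∃ (t₀ : FMon ψ r) (c : Mon V), IsLeadF ψ g.1 t₀ ∧ t₀.idx = t.idx ∧
      IsSmallCofactor ψ t₀.mon c t.mon ∧ g.2.mul c = some q := by
  obtain ⟨f, hf, hft⟩ := h.1
  have hsigned : (f, q) ∈ signedElements ψ ghat :=
    ⟨isSigned_of_mem_evSpan hf fun hf' => h.2 f hf' hft, hft.ne_zero hψ⟩
  have hlow : ∀ g ∈ signedElements ψ ghat, ∀ q', TopReduces ψ g f q' → ¬ q' < q := by
    intro g hg q' hgq hlt
    obtain ⟨f', hf', hft'⟩ := hgq.exists_mem_evSpan hψ hE hF hg.1 hft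
    exact h.2 f' (evSpan_mono (Set.Iic_subset_Iio.mpr hlt) hf') hft'
  -- By newness no signed element reduces `f` strictly below `q`; the weak reduction provided by `G`
  -- must then have signature exactly `q`.
  obtain ⟨g, hg, q', hgq, hle⟩ := hG.reducible _ hsigned
    (Or.inr fun ⟨g, hg, q', hgq, hlt⟩ => hlow g hg q' hgq hlt)
  have hqq : q' = q := hle.eq_or_lt.resolve_right (hlow g (hG.signed hg) q' hgq)
  obtain ⟨t₀, u, c, hgt, hfu, hi, hc, hq⟩ := hgq
  obtain rfl := hft.unique hψ hfu
  exact ⟨g, hg, t₀, c, hgt, hi, hc, hqq ▸ hq⟩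

/-- If `t` already occurred below `q`, the element of `G` realising it where it is new would reduce
`f` in a signature smaller than `q`. -/
theorem isNewLead_of_sigIrreducible (hψ : IsBasicPresentation ψ) (hE : IsMonomialOrderE m V)
    (hneg : IsNegDegOrderE m V) (hF : IsMonomialOrderF ψ r)
    {G : Set ((Fin r → A) × EMon m V)} (hG : IsSignedStandardBasis ψ ghat G)
    {f : Fin r → A} {t : FMon ψ r} {q : EMon m V} (hf : f ∈ evSpan ψ ghat (Set.Iic q))
    (hft : IsLeadF ψ f t) (hirr : SigIrreducible ψ G f q) : IsNewLead ghat t q := by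
  refine ⟨⟨f, hf, hft⟩, fun f' hf' hft' => ?_⟩
  rcases eq_zero_or_exists_mem_evSpan_Iic hf' with rfl | ⟨p, hp, hf''⟩
  · exact hft'.ne_zero hψ rfl
  obtain ⟨q', hq', hnew⟩ := exists_isNewLead hψ hneg hf'' hft'
  obtain ⟨g, hg, t₀, c, hgt, hi, hc, hq⟩ := hnew.exists_mem hψ hE hF hG
  rcases hirr with h0 | h
  · exact hft.ne_zero hψ h0
  · exact h ⟨g, hg, q', ⟨t₀, t, c, hgt, hft, hi, hc, hq⟩, lt_of_le_of_lt hq' hp⟩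

theorem exists_isNewLead_of_mem_layerBasis (hψ : IsBasicPresentation ψ)
    (hE : IsMonomialOrderE m V) (hneg : IsNegDegOrderE m V) (hF : IsMonomialOrderF ψ r)
    {G : Set ((Fin r → A) × EMon m V)} (hG : IsSignedStandardBasis ψ ghat G)
    {τ : WithBot (EMon m V)} {f : Fin r → A} (hf : f ∈ layerBasis ψ G τ) :
    ∃ g ∈ G, ∃ (t t' : FMon ψ r) (c : Mon V) (q : EMon m V), IsLeadF ψ g.1 t ∧ t.idx = t'.idx ∧
      IsSmallCofactor ψ t.mon c t'.mon ∧ g.2.mul c = some q ∧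
      f = op (ψ (mon K c)) • g.1 ∧ (q : WithBot (EMon m V)) ≤ τ ∧ IsLeadF ψ f t' ∧
      f ∈ evSpan ψ ghat (Set.Iic q) ∧ IsNewLead ghat t' q := by
  obtain ⟨g, hg, t, c, d, q, ht, hc, hq, hle, rfl, hirr⟩ := hf
  have hlead := ht.op_smul hψ hF hc
  have hmem := (hG.signed hg).1.op_smul_mem_evSpan hE hq
  exact ⟨g, hg, t, ⟨t.idx, d, hc.2.2.2⟩, c, q, ht, rfl, hc, hq, rfl, hle, hlead, hmem,
    isNewLead_of_sigIrreducible hψ hE hneg hF hG hmem hlead hirr⟩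

/-- The common leading monomial determines the signature, and the two together determine the
generator and the cofactor. -/
theorem eq_of_mem_layerBasis (hψ : IsBasicPresentation ψ) (hV : IsMonomialOrder V)
    (hE : IsMonomialOrderE m V) (hneg : IsNegDegOrderE m V) (hF : IsMonomialOrderF ψ r)
    {G : Set ((Fin r → A) × EMon m V)} (hG : IsSignedStandardBasis ψ ghat G)
    (hGred : IsInterreduced ψ G) {τ : WithBot (EMon m V)} {f f' : Fin r → A}
    (hf : f ∈ layerBasis ψ G τ) (hf' : f' ∈ layerBasis ψ G τ) {t : FMon ψ r}
    (ht : IsLeadF ψ f t) (ht' : IsLeadF ψ f' t) : f = f' := by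
  obtain ⟨g, hg, t₀, t₁, c, q, hgt, hi, hc, hq, hfg, -, hft, -, hnew⟩ :=
    exists_isNewLead_of_mem_layerBasis hψ hE hneg hF hG hf
  obtain ⟨g', hg', t₀', t₁', c', q', hgt', hi', hc', hq', hfg', -, hft', -, hnew'⟩ :=
    exists_isNewLead_of_mem_layerBasis hψ hE hneg hF hG hf'
  obtain rfl := ht.unique hψ hft
  obtain rfl := ht'.unique hψ hft'
  obtain rfl := hnew.unique hnew'
  obtain ⟨rfl, rfl⟩ := hGred.eq_of_mul_eq hV hg hg' hgt hgt' (hi.trans hi'.symm) hc hc' hq hq'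
  rw [hfg, hfg']

theorem linearIndependent_layerBasis (hψ : IsBasicPresentation ψ) (hV : IsMonomialOrder V)
    (hE : IsMonomialOrderE m V) (hneg : IsNegDegOrderE m V) (hF : IsMonomialOrderF ψ r)
    {G : Set ((Fin r → A) × EMon m V)} (hG : IsSignedStandardBasis ψ ghat G)
    (hGred : IsInterreduced ψ G) (τ : WithBot (EMon m V)) :
    LinearIndependent K ((↑) : layerBasis ψ G τ → (Fin r → A)) := by
  refine linearIndependent_of_isLeadIndex (b := fBasis hψ r) (fun h0 => ?_) ?_
  · obtain ⟨_, _, _, t, _, _, _, _, _, _, _, _, hlead, _⟩ :=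
      exists_isNewLead_of_mem_layerBasis hψ hE hneg hF hG h0
    exact hlead.ne_zero hψ rfl
  · simp only [← isLeadF_iff_isLeadIndex hψ]
    exact fun f hf f' hf' t ht ht' => eq_of_mem_layerBasis hψ hV hE hneg hF hG hGred hf hf' ht ht'

theorem span_layerBasis (hψ : IsBasicPresentation ψ)
    (hE : IsMonomialOrderE m V) (hneg : IsNegDegOrderE m V) (hF : IsMonomialOrderF ψ r)
    {G : Set ((Fin r → A) × EMon m V)} (hG : IsSignedStandardBasis ψ ghat G)
    (τ : WithBot (EMon m V)) :
    Submodule.span K (layerBasis ψ G τ) =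
      evSpan ψ ghat {q | (q : WithBot (EMon m V)) ≤ τ} := by
  have := FMon.finite hψ r
  have hsub : layerBasis ψ G τ ⊆ evSpan ψ ghat {q | (q : WithBot (EMon m V)) ≤ τ} := by
    intro f hf
    obtain ⟨_, _, _, _, _, q, _, _, _, _, _, hle, _, hmem, _⟩ :=
      exists_isNewLead_of_mem_layerBasis hψ hE hneg hF hG hf
    exact evSpan_mono (fun s hs => (WithBot.coe_le_coe.mpr hs).trans hle) hmem
  refine le_antisymm (Submodule.span_le.mpr hsub)
    (le_span_of_isLeadIndex (b := fBasis hψ r) hsub ?_)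
  simp only [← isLeadF_iff_isLeadIndex hψ]
  intro f hf t ht
  rcases eq_zero_or_exists_mem_evSpan_Iic hf with rfl | ⟨p, hp, hfp⟩
  · exact absurd rfl (ht.ne_zero hψ)
  obtain ⟨q, hqp, hnew⟩ := exists_isNewLead hψ hneg hfp ht
  obtain ⟨g, hg, t₀, c, hgt, hi, hc, hq⟩ := hnew.exists_mem hψ hE hF hG
  have hlead := hgt.op_smul hψ hF hc
  rw [show (⟨t₀.idx, t.mon, hc.2.2.2⟩ : FMon ψ r) = t from FMon.ext hi rfl] at hlead
  refine ⟨_, ⟨g, hg, t₀, c, t.mon, q, hgt, hc, hq, (WithBot.coe_le_coe.mpr hqp).trans hp, rfl,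
    Or.inr ?_⟩, hlead⟩
  -- A reduction of the chosen product would place `t` strictly below the signature at which it is
  -- new.
  rintro ⟨g', hg', q', hred, hlt⟩
  obtain ⟨f', hf', hft'⟩ := hred.exists_mem_evSpan hψ hE hF (hG.signed hg').1 hlead
  exact hnew.2 f' (evSpan_mono (Set.Iic_subset_Iio.mpr hlt) hf') hft'

end Signatures

/-! ### The iterated radicals as images of the monomials of bounded below degree. -/

section Radical

variable {K : Type w} {V : Type u} [Field K] [Quiver.{v} V] [Fintype V]
variable {A : Type*} [Ring A] [Algebra K A] {ψ : PathAlgebra K V →ₐ[K] A}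
variable {m r : ℕ} {ghat : Fin m → Fin r → A}

/-- The submodule generated by the evaluations of the monomials of degree at least `k`. -/
noncomputable def degSpan (ψ : PathAlgebra K V →ₐ[K] A) (ghat : Fin m → Fin r → A) (k : ℕ) :
    Submodule Aᵐᵒᵖ (Fin r → A) :=
  Submodule.span Aᵐᵒᵖ (evMon ψ ghat '' {s | k ≤ s.deg})

theorem mem_of_forall_mon_smul_mem (hψ : Function.Surjective ψ) {W : Submodule K (Fin r → A)}
    {x : Fin r → A} (h : ∀ c : Mon V, op (ψ (mon K c)) • x ∈ W) (a : Aᵐᵒᵖ) : a • x ∈ W := by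
  obtain ⟨a, rfl⟩ := op_surjective a
  obtain ⟨p, rfl⟩ := hψ a
  rw [map_eq_sum, Finset.op_sum, Finset.sum_smul]
  refine Submodule.sum_mem _ fun b _ => ?_
  rw [op_smul, smul_assoc]
  exact Submodule.smul_mem _ _ (h b)

theorem mon_smul_mem_evSpan_deg {k : ℕ} {x : Fin r → A}
    (hx : x ∈ evSpan ψ ghat {s | k ≤ s.deg}) (c : Mon V) :
    op (ψ (mon K c)) • x ∈ evSpan ψ ghat {s | k + c.deg ≤ s.deg} := by
  refine op_smul_mem_evSpan (fun s hs t ht => ?_) hx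
  have := EMon.deg_mul ht
  simp only [Set.mem_ofPred_eq] at hs ⊢
  omega

/-- Multiplication by a path never lowers the degree, so the `K`-span is already stable under `A`.
-/
theorem mem_degSpan (hψ : Function.Surjective ψ) {k : ℕ} {x : Fin r → A} :
    x ∈ degSpan ψ ghat k ↔ x ∈ evSpan ψ ghat {s | k ≤ s.deg} := by
  constructor
  · intro hx
    induction hx using Submodule.span_induction with
    | mem x hx => exact Submodule.subset_span hx
    | zero => exact Submodule.zero_mem _
    | add x y _ _ hx hy => exact Submodule.add_mem _ hx hy
    | smul a x _ hx =>
      refine mem_of_forall_mon_smul_mem hψ (fun c => ?_) a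
      exact evSpan_mono (fun s hs => le_trans (Nat.le_add_right k c.deg) hs)
        (mon_smul_mem_evSpan_deg hx c)
  · intro hx
    have : evSpan ψ ghat {s | k ≤ s.deg} ≤ (degSpan ψ ghat k).restrictScalars K :=
      Submodule.span_le.mpr Submodule.subset_span
    exact this hx

theorem mon_smul_mem_degSpan (hψ : Function.Surjective ψ) {k : ℕ} {x : Fin r → A}
    (hx : x ∈ degSpan ψ ghat k) (c : Mon V) :
    op (ψ (mon K c)) • x ∈ degSpan ψ ghat (k + c.deg) := by
  rw [mem_degSpan hψ] at hx ⊢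
  exact mon_smul_mem_evSpan_deg hx c

theorem degSpan_antitone {k l : ℕ} (h : k ≤ l) : degSpan ψ ghat l ≤ degSpan ψ ghat k :=
  Submodule.span_mono (Set.image_mono fun _ hs => h.trans hs)

theorem sum_triv_smul (x : Fin r → A) :
    ∑ a : V, op (ψ (mon K (Mon.triv a))) • x = x := by
  rw [← Finset.sum_smul, ← Finset.op_sum, ← map_sum, ← one_def, map_one, op_one, one_smul]

theorem degSpan_zero : degSpan ψ ghat 0 = Submodule.span Aᵐᵒᵖ (Set.range ghat) := by
  refine le_antisymm (Submodule.span_le.mpr ?_) (Submodule.span_le.mpr ?_)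
  · rintro _ ⟨s, -, rfl⟩
    exact Submodule.smul_mem _ _ (Submodule.subset_span ⟨s.idx, rfl⟩)
  · rintro _ ⟨i, rfl⟩
    rw [← sum_triv_smul (ψ := ψ) (ghat i)]
    exact Submodule.sum_mem _ fun a _ =>
      Submodule.subset_span ⟨⟨i, Mon.triv a⟩, Nat.zero_le _, rfl⟩

theorem mem_rad {R X : Type*} [Ring R] [AddCommGroup X] [Module R X] {N : Submodule R X} {x : X} :
    x ∈ rad N ↔ ∃ h : x ∈ N, ∀ Y : Submodule R N, IsCoatom Y → ⟨x, h⟩ ∈ Y := by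
  simp only [rad, Submodule.mem_map, Module.jacobson, Submodule.mem_sInf, Set.mem_ofPred_eq,
    Submodule.subtype_apply, Subtype.exists, exists_and_right, exists_eq_right]

/-- Nakayama's argument with the nilpotent arrow ideal: a maximal submodule `Y` missing some element
of the next term would, together with that term, generate everything, and then contain that term
after all. -/
theorem degSpan_succ_le_rad (hψ : IsBasicPresentation ψ) (k : ℕ) :
    degSpan ψ ghat (k + 1) ≤ rad (degSpan ψ ghat k) := by
  obtain ⟨N, hN⟩ := hψ.le_ker
  have hN : ∀ s : EMon m V, N ≤ s.deg → evMon ψ ghat s = 0 := by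
    classical
    intro s hs
    rw [evMon, hN, op_zero, zero_smul]
    intro b hb
    rw [coeff_mon] at hb
    split_ifs at hb with h
    · exact h ▸ hs
    · exact absurd rfl hb
  intro x hx
  have hle := degSpan_antitone (ψ := ψ) (ghat := ghat) (Nat.le_succ k)
  refine mem_rad.mpr ⟨hle hx, fun Y hY => ?_⟩
  by_contra hxY
  have htop : Y ⊔ (degSpan ψ ghat (k + 1)).submoduleOf (degSpan ψ ghat k) = ⊤ := by
    refine hY.2 _ (lt_of_le_of_ne le_sup_left fun h => hxY ?_)
    rw [h]
    exact Submodule.mem_sup_right hx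
  -- Downward induction on the degree, starting at `N`, where evaluations vanish. Splitting `s`
  -- after a prefix of degree `k` and decomposing the prefix along `htop` leaves an error of degree
  -- greater than that of `s`.
  have key : ∀ n, ∀ s : EMon m V, N ≤ n + s.deg → k + 1 ≤ s.deg →
      evMon ψ ghat s ∈ Y.map (degSpan ψ ghat k).subtype := by
    intro n
    induction n with
    | zero =>
      intro s hs _
      rw [hN s (by omega)]
      exact Submodule.zero_mem _
    | succ n ih =>
      intro s hs hk
      obtain ⟨t, c, ht, htc⟩ := s.exists_prefix (k := k) (by omega)
      have hdeg := EMon.deg_mul htc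
      have htk : evMon ψ ghat t ∈ degSpan ψ ghat k := Submodule.subset_span ⟨t, ht.ge, rfl⟩
      obtain ⟨y, hy, z, hz, hyz⟩ := Submodule.mem_sup.mp
        (htop ▸ Submodule.mem_top : (⟨_, htk⟩ : degSpan ψ ghat k) ∈
          Y ⊔ (degSpan ψ ghat (k + 1)).submoduleOf (degSpan ψ ghat k))
      have hyz : (y : Fin r → A) + z = evMon ψ ghat t := congrArg Subtype.val hyz
      have hs' : evMon ψ ghat s =
          op (ψ (mon K c)) • (y : Fin r → A) + op (ψ (mon K c)) • (z : Fin r → A) := by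
        rw [← smul_add, hyz, op_smul_evMon, htc]
        rfl
      rw [hs']
      refine Submodule.add_mem _ (Submodule.smul_mem _ _ ⟨y, hy, rfl⟩) ?_
      have hz' := (mem_degSpan hψ.surjective).mp (mon_smul_mem_degSpan hψ.surjective hz c)
      have hle' : evSpan ψ ghat {s | k + 1 + c.deg ≤ s.deg} ≤
          (Y.map (degSpan ψ ghat k).subtype).restrictScalars K := by
        refine Submodule.span_le.mpr ?_
        rintro _ ⟨u, hu, rfl⟩
        simp only [Set.mem_ofPred_eq] at hu
        exact ih u (by omega) (by omega)
      exact hle' hz'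
  have hle' : degSpan ψ ghat (k + 1) ≤ Y.map (degSpan ψ ghat k).subtype := by
    refine Submodule.span_le.mpr ?_
    rintro _ ⟨s, hs, rfl⟩
    exact key N s (Nat.le_add_right _ _) hs
  obtain ⟨y, hy, rfl⟩ := hle' hx
  exact hxY hy

/-- An element outside the next term is separated from it by a maximal submodule, namely the kernel
of a suitable linear functional. -/
theorem rad_degSpan_le (hψ : Function.Surjective ψ) (k : ℕ) :
    rad (degSpan ψ ghat k) ≤ degSpan ψ ghat (k + 1) := by
  intro x hx
  obtain ⟨hxk, hx⟩ := mem_rad.mp hx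
  by_contra hx1
  obtain ⟨a, ha⟩ : ∃ a : V, op (ψ (mon K (Mon.triv a))) • x ∉ degSpan ψ ghat (k + 1) := by
    by_contra! h
    refine hx1 ?_
    rw [← sum_triv_smul (ψ := ψ) x]
    exact Submodule.sum_mem _ fun a _ => h a
  obtain ⟨φ, hφa, hφ⟩ := Submodule.exists_le_ker_of_notMem
    (p := (degSpan ψ ghat (k + 1)).restrictScalars K) ha
  -- The kernel of `φ` alone need not be a submodule. After projection to one vertex, trivial paths
  -- act on `θ` as `1` or `0`, and longer paths land in the next term, where `φ` vanishes.
  set θ : (Fin r → A) →ₗ[K] K := φ ∘ₗ rightMul K r (ψ (mon K (Mon.triv a))) with hθ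
  have hθx : θ x ≠ 0 := hφa
  have hmon : ∀ y ∈ degSpan ψ ghat k, θ y = 0 → ∀ c : Mon V,
      op (ψ (mon K c)) • y ∈ LinearMap.ker θ := by
    intro y hy hy0 c
    rw [LinearMap.mem_ker]
    change φ (op (ψ (mon K (Mon.triv a))) • op (ψ (mon K c)) • y) = 0
    rcases Nat.eq_zero_or_pos c.deg with hc | hc
    · obtain ⟨b, rfl⟩ := Mon.deg_eq_zero hc
      rw [smul_smul, ← op_mul, ← map_mul]
      by_cases hab : b = a
      · subst hab
        rw [mon_mul_mon_of_eq_some (c := Mon.triv b) (Mon.mul_triv (Mon.triv b))]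
        exact hy0
      · rw [mon_mul_mon_of_eq_none (Mon.mul_of_ne hab)]
        simp
    · refine hφ ?_
      exact Submodule.smul_mem _ _ (degSpan_antitone (by omega) (mon_smul_mem_degSpan hψ hy c))
  let Y : Submodule Aᵐᵒᵖ (degSpan ψ ghat k) :=
    { carrier := {y | θ y.1 = 0}
      add_mem' := fun {y z} hy hz => by
        simp only [Set.mem_ofPred_eq] at hy hz ⊢
        rw [Submodule.coe_add, map_add, hy, hz, add_zero]
      zero_mem' := map_zero θ
      smul_mem' := fun c y hy => mem_of_forall_mon_smul_mem hψ (hmon y.1 y.2 hy) c }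
  have hY : IsCoatom Y := by
    refine ⟨fun h => ?_, fun Z hYZ => ?_⟩
    · exact hθx (h ▸ Submodule.mem_top : (⟨x, hxk⟩ : degSpan ψ ghat k) ∈ Y)
    -- `Y` has codimension one over `K`, so any `z` outside `Y` spans a complement.
    · obtain ⟨z, hzZ, hzY⟩ := SetLike.exists_of_lt hYZ
      have hz0 : θ z.1 ≠ 0 := hzY
      rw [eq_top_iff]
      intro y _
      have h1 : y - (θ y.1 / θ z.1) • z ∈ Y := by
        change θ (y.1 - (θ y.1 / θ z.1) • z.1) = 0
        rw [map_sub, map_smul, smul_eq_mul, div_mul_cancel₀ _ hz0, sub_self]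
      have h2 := Z.add_mem (hYZ.le h1) (Z.smul_of_tower_mem (θ y.1 / θ z.1) hzZ)
      rwa [sub_add_cancel] at h2
  exact hθx (hx Y hY)

theorem radPow_eq_degSpan (hψ : IsBasicPresentation ψ) {M : Submodule Aᵐᵒᵖ (Fin r → A)}
    (hM : Submodule.span Aᵐᵒᵖ (Set.range ghat) = M) (k : ℕ) :
    radPow M k = degSpan ψ ghat k := by
  induction k with
  | zero => rw [degSpan_zero, hM]; rfl
  | succ k ih =>
    rw [radPow, ih]
    exact le_antisymm (rad_degSpan_le hψ.surjective k) (degSpan_succ_le_rad hψ k)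

end Radical

/-! ### Bases of quotients from nested bases. -/

section Quotient

variable {K R X : Type*} [Field K] [Ring R] [AddCommGroup X] [Module R X] [Module K X]
  [SMul K R] [IsScalarTower K R X]

/-- If `B' ⊆ B` are `K`-bases of the submodules `S' ≤ S`, then the classes of the elements of
`B \ B'` form a basis of the quotient. -/
theorem exists_basis_quotient {S S' : Submodule R X} {B B' : Set X} (hBB : B' ⊆ B)
    (hB : LinearIndependent K ((↑) : B → X)) (hS : ∀ x, x ∈ S ↔ x ∈ Submodule.span K B)
    (hS' : ∀ x, x ∈ S' ↔ x ∈ Submodule.span K B') :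
    ∃ (h : ∀ f ∈ B \ B', f ∈ S) (b : Module.Basis ↥(B \ B') K (S ⧸ S'.submoduleOf S)),
      ∀ f, b f = Submodule.Quotient.mk ⟨f.1, h f.1 f.2⟩ := by
  have h : ∀ f ∈ B \ B', f ∈ S := fun f hf => (hS f).mpr (Submodule.subset_span hf.1)
  -- This is what turns a relation modulo `S'` into a relation in `X`.
  have hdisj : Disjoint (Submodule.span K (B \ B')) (Submodule.span K B') := by
    have := hB.disjoint_span_image (s := {f | f.1 ∉ B'}) (t := {f | f.1 ∈ B'})
      (Set.disjoint_left.mpr fun _ h h' => h h')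
    refine this.mono (Submodule.span_mono ?_) (Submodule.span_mono ?_)
    · exact fun f hf => ⟨⟨f, hf.1⟩, hf.2, rfl⟩
    · exact fun f hf => ⟨⟨f, hBB hf⟩, hf, rfl⟩
  set v : ↥(B \ B') → S ⧸ S'.submoduleOf S :=
    fun f => Submodule.Quotient.mk ⟨f.1, h f.1 f.2⟩ with hv
  have hLI : LinearIndependent K v := by
    have hdiff : LinearIndependent K ((↑) : ↥(B \ B') → X) := 
      hB.comp (Set.inclusion Set.sdiff_subset) (Set.inclusion_injective _)
    rw [linearIndependent_iff'] at hdiff ⊢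
    intro s g hg i hi
    refine hdiff s g ?_ i hi
    have e : ∑ j ∈ s, g j • v j =
        Submodule.Quotient.mk (∑ j ∈ s, g j • (⟨j.1, h j.1 j.2⟩ : S)) := by
      rw [← Submodule.mkQ_apply, map_sum]
      rfl
    rw [e, Submodule.Quotient.mk_eq_zero, Submodule.submoduleOf, Submodule.mem_comap, hS'] at hg
    have hg' : ∑ j ∈ s, g j • (j : X) ∈ Submodule.span K B' := by
      simpa using hg
    exact (Submodule.disjoint_def.mp hdisj) _
      (Submodule.sum_mem _ fun j _ => Submodule.smul_mem _ _ (Submodule.subset_span j.2)) hg'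
  have hmem : ∀ x, x ∈ Submodule.span K B → ∀ hx : x ∈ S,
      (Submodule.Quotient.mk ⟨x, hx⟩ : S ⧸ S'.submoduleOf S) ∈
        Submodule.span K (Set.range v) := by
    intro x hx
    induction hx using Submodule.span_induction with
    | mem x hxB =>
      intro hx
      by_cases hx' : x ∈ B'
      · rw [(Submodule.Quotient.mk_eq_zero _).mpr
          (show _ ∈ S'.submoduleOf S from (hS' x).mpr (Submodule.subset_span hx'))]
        exact Submodule.zero_mem _
      · exact Submodule.subset_span ⟨⟨x, hxB, hx'⟩, rfl⟩
    | zero => exact fun hx => Submodule.zero_mem _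
    | add x y hx hy ihx ihy =>
      exact fun _ => Submodule.add_mem _ (ihx ((hS x).mpr hx)) (ihy ((hS y).mpr hy))
    | smul a x hx ih =>
      exact fun _ => Submodule.smul_mem _ a (ih ((hS x).mpr hx))
  refine ⟨h, Module.Basis.mk hLI ?_, fun f => Module.Basis.mk_apply _ _ f⟩
  intro x _
  obtain ⟨y, rfl⟩ := Submodule.Quotient.mk_surjective _ x
  exact hmem y.1 ((hS _).mp y.2) y.2

end Quotient

end SignedStd

open SignedStd
theorem mainTheorem2 {K V A : Type*} [Field K] [Quiver V] [Fintype V]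
    [∀ a b : V, Finite (a ⟶ b)] [Ring A] [Algebra K A]
    (ψ : PathAlgebra K V →ₐ[K] A) (hψ : IsBasicPresentation ψ)
    [LinearOrder (Mon V)] (hV : IsMonomialOrder V)
    {m r : ℕ} [LinearOrder (EMon m V)] (hE : IsMonomialOrderE m V) (hneg : IsNegDegOrderE m V)
    [LinearOrder (FMon ψ r)] (hF : IsMonomialOrderF ψ r)
    (M : Submodule Aᵐᵒᵖ (Fin r → A)) (ghat : Fin m → Fin r → A)
    (hM : Submodule.span Aᵐᵒᵖ (Set.range ghat) = M)
    (G : Set ((Fin r → A) × EMon m V)) (hG : IsSignedStandardBasis ψ ghat G)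
    (hGred : IsInterreduced ψ G)
    (d : ℕ) (hd : 0 < d) (τ τ' : WithBot (EMon m V))
    (hτ : IsTopOfDegree (d - 1) τ) (hτ' : IsTopOfDegree d τ') :
    ∃ (h : ∀ f ∈ layerBasis ψ G τ \ layerBasis ψ G τ', f ∈ radPow M (d - 1))
      (b : Module.Basis ↥(layerBasis ψ G τ \ layerBasis ψ G τ') K (LoewyLayer M d)),
      ∀ f, b f = Submodule.Quotient.mk ⟨f.1, h f.1 f.2⟩ := by
  have hspan : ∀ (k : ℕ) (σ : WithBot (EMon m V)), IsTopOfDegree k σ →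
      ∀ x, x ∈ radPow M k ↔ x ∈ Submodule.span K (layerBasis ψ G σ) := by
    intro k σ hσ x
    rw [radPow_eq_degSpan hψ hM, mem_degSpan hψ.surjective, span_layerBasis hψ hE hneg hF hG]
    simp only [hσ.le_iff hneg]
  refine exists_basis_quotient ?_ (linearIndependent_layerBasis hψ hV hE hneg hF hG hGred τ)
    (hspan _ τ hτ) (hspan _ τ' hτ')
  rintro f ⟨g, hg, t, c, e, q, ht, hc, hq, hle, hf⟩
  refine ⟨g, hg, t, c, e, q, ht, hc, hq, ?_, hf⟩
  -- Nestedness of the two sets: in terms of degrees, `d ≤ q.deg` implies `d - 1 ≤ q.deg`.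
  rw [hτ'.le_iff hneg] at hle
  rw [hτ.le_iff hneg]
  omega
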